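/- **Setting.** Let $\mathcal S,\mathcal A$ be finite sets with $S=|\mathcal S|\ge 2$ and $A=|\mathcal A|\ge 1$, and let $p_{s,a}$ (a probability vector on $\mathcal S$) be the transition law of an MDP. For a policy $\pi:\mathcal S\to\mathcal A$ and states $s\ne s'$, let $h_\pi(s,s')\in[1,\infty]$ be the expectation of $\min\{t>0: s_t=s'\}$ for the Markov chain with $s_0=s$ and $s_{t+1}\sim p_{s_t,\pi(s_t)}$. Assume that the MDP is communicating, i.e. for all $s\neq s'$ some $\pi$ has $h_\pi(s,s')<\infty$, and let $D=\max_{s\ne s'}\min_\pi h_\pi(s,s')$ be its diameter. A generative model returns, at each call at $(s,a)$, an independent sample of $p_{s,a}$; let $\hat p_{s,a,n}$ be the empirical distribution of its first $n$ answers at $(s,a)$. For $\delta\in(0,1)$, $n\ge1$ and $\eta>0$ put $$B(n,\delta)=\sqrt{\frac{2\log(SA/\delta)+2(S-1)\log\left(e\left(1+\frac{n}{S-1}\right)\right)}{n}},\qquad N(\delta,\eta)=\inf\{n>0: B(n,\delta)\le\eta\}.$$ **EVI-SSP.** Given a goal state $g$, sets $\mathcal P(s,a)$ of probability vectors on $\mathcal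 S$ and a precision $\mu>0$, define $\widetilde L v(g)=0$ and $\widetilde Lv(s)=\min_{a}\left[1+\min_{q\in\mathcal P(s,a)}\sum_{s'}q(s')v(s')\right]$ for $s\ne g$. Let $v_0=0$ and $v_{j+1}=\widetilde Lv_j$. The output is $\widetilde v^{(g)}=v_j$ for the least $j$ with $\|v_{j+1}-v_j\|_\infty\le\mu$ (unit costs). **Diameter estimation procedure** with parameters $\varepsilon,\delta$. Start with $W=\frac12$ and $\widetilde v_\infty=1$. While $\widetilde v_\infty>W$: replace $W$ by $2W$; set $\eta=\frac{\varepsilon}{4W}$ and $N=N(\delta,\eta)$; call the generative model until each $(s,a)$ has received $N$ calls in total (earlier samples are kept); let $\mathcal P(s,a)$ be the set of probability vectors $q$ with $\|q-\hat p_{s,a,N}\|_1\le\eta$; for every $g\in\mathcal S$ run EVI-SSP with goal $g$, sets $\mathcal P(s,a)$ and precision $\frac{\min(1,\varepsilon)}{2}$; set $\widetilde v_\infty=\max_g\max_{s\neq g}\widetilde v^{(g)}(s)$. At the end return $$\widehat D=\bigl(1+2\eta(1+\varepsilon)\widetilde v_\infty\bigr)(1+\varepsilon)\,\widetilde v_\infty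 .$$ **Theorem.** Let $0<\varepsilon\le1$ and $\delta\in(0,1)$. With probability at least $1-\delta$, the procedure terminates, its output satisfies $$D\le\widehat D\le\left(1+\frac{\varepsilon(1+\varepsilon)}{2}\right)(1+\varepsilon)D,$$ and the total number of calls of the generative model is at most $SA\cdot N\!\left(\delta,\frac{\varepsilon}{8D}\right)$. Moreover $$SA\cdot N\!\left(\delta,\tfrac{\varepsilon}{8D}\right)=\widetilde{\mathcal O}\left(\frac{D^2SA}{\varepsilon^2}\log\frac1\delta+\frac{D^2S^2A}{\varepsilon^2}\right),$$ i.e. there are absolute constants $C>0$ and $k\in\mathbb N$ such that, for every such MDP and all such $\varepsilon,\delta$, the left side is at most $C$ times the expression in parentheses times $\log^k\!\left(2+S+A+D+\frac1\varepsilon+\log\frac1\delta\right)$. -/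

import Mathlib

open MeasureTheory ProbabilityTheory
open scoped ENNReal

noncomputable section

namespace DiameterEstimation

/-! ### Finite Markov decision processes and their diameter

A finite MDP with state space `S`, action space `A` is given by its transition law
`P : S → A → PMF S` (`P s a` is the law of the next state). Rewards play no role in the diameter or
in its estimation, so they are not recorded. -/

section Diameter

variable {S A : Type*} [Fintype S] [MeasurableSpace S] [MeasurableSingletonClass S]

/-- The one-step transition kernel of the Markov chain obtained by following the stationary
deterministic policy `π`. -/
def policyKernel (P : S → A → PMF S) (π : S → A) : Kernel S S :=
  Kernel.ofFunOfCountable fun s => (P s (π s)).toMeasure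

instance (P : S → A → PMF S) (π : S → A) : IsMarkovKernel (policyKernel P π) :=
  ⟨fun s => by
    change IsProbabilityMeasure (P s (π s)).toMeasure
    infer_instance⟩

/-- The law of the next state given the whole history `s₀, …, sₙ`: it depends on `sₙ` only. -/
def historyKernel (P : S → A → PMF S) (π : S → A) (n : ℕ) :
    Kernel (Π _ : Finset.Iic n, S) S :=
  (policyKernel P π).comap (fun h => h ⟨n, Finset.mem_Iic.2 le_rfl⟩) (measurable_pi_apply _)

instance (P : S → A → PMF S) (π : S → A) (n : ℕ) : IsMarkovKernel (historyKernel P π n) := by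
  unfold historyKernel
  infer_instance

/-- The law of the trajectory `s₀, s₁, s₂, …` with `s₀ = s` when actions are chosen by `π`. -/
def trajLaw (P : S → A → PMF S) (π : S → A) (s : S) : Measure (ℕ → S) :=
  Kernel.traj (X := fun _ => S) (historyKernel P π) 0 (fun _ => s)

/-- The first time `t > 0` at which the trajectory `x` is in state `g` (`∞` if there is none). -/
def hittingTime (g : S) (x : ℕ → S) : ℝ≥0∞ :=
  ⨅ t : ℕ, ⨅ _ : 0 < t ∧ x t = g, (t : ℝ≥0∞)

/-- The expected number of steps that policy `π` needs to go from `s` to `g`. -/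
def expectedHittingTime (P : S → A → PMF S) (π : S → A) (s g : S) : ℝ≥0∞ :=
  ∫⁻ x, hittingTime g x ∂(trajLaw P π s)

/-- The MDP is communicating: from every state, every other state can be reached in finite expected
time by some policy. -/
def Communicating (P : S → A → PMF S) : Prop :=
  ∀ s g : S, s ≠ g → ∃ π : S → A, expectedHittingTime P π s g < ∞

/-- The diameter `max_{s ≠ g} min_π 𝔼[hitting time of g from s]`. -/
def diameter (P : S → A → PMF S) : ℝ≥0∞ :=
  ⨆ s : S, ⨆ g : S, ⨆ _ : s ≠ g, ⨅ π : S → A, expectedHittingTime P π s g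

end Diameter

/-! ### Confidence width and number of samples -/

/-- `B(n, δ) = √((2 log(SA/δ) + 2 (S-1) log(e (1 + n/(S-1)))) / n)` for `S = nS`, `A = nA`. -/
def confWidth (nS nA : ℕ) (δ : ℝ) (n : ℕ) : ℝ :=
  √((2 * Real.log (nS * nA / δ) +
      2 * ((nS : ℝ) - 1) * Real.log (Real.exp 1 * (1 + n / ((nS : ℝ) - 1)))) / n)

/-- `N(δ, η) = inf {n > 0 : B(n, δ) ≤ η}`. -/
def sampleSize (nS nA : ℕ) (δ η : ℝ) : ℕ :=
  sInf {n : ℕ | 0 < n ∧ confWidth nS nA δ n ≤ η}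

/-! ### Extended value iteration for stochastic shortest paths -/

section EVI

variable {S A : Type*} [Fintype S]

open Classical in
/-- The extended optimal Bellman operator with cost `c`, goal state `g` and sets of plausible
transitions `Pl s a`:
`v ↦ min_a (c s a + min_{q ∈ Pl s a} ∑ s', q s' * v s')` for `s ≠ g`, and `0` at `g`. -/
def extBellman (c : S → A → ℝ) (g : S) (Pl : S → A → Set (S → ℝ)) (v : S → ℝ) : S → ℝ :=
  fun s => if s = g then 0
    else ⨅ a : A, (c s a + sInf ((fun q : S → ℝ => ∑ s', q s' * v s') '' Pl s a))

/-- The `j`-th iterate `v_j` of extended value iteration, with `v₀ = 0`. -/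
def eviIter (c : S → A → ℝ) (g : S) (Pl : S → A → Set (S → ℝ)) (j : ℕ) : S → ℝ :=
  (extBellman c g Pl)^[j] 0

/-- `EVI-SSP` with cost `c` and goal `g`, run on `Pl` with precision `prec`, stops and its value
output is `v`: `v = v_j` for the least `j` with `‖v_{j+1} - v_j‖ ≤ prec` (sup norm). (The optimistic
kernel and the greedy policy that `EVI-SSP` computes from `v` are not used by the diameter estimation
procedure.) -/
def EVIReturns (c : S → A → ℝ) (g : S) (Pl : S → A → Set (S → ℝ)) (prec : ℝ) (v : S → ℝ) : Prop :=
  ∃ j : ℕ, IsLeast {i : ℕ | ‖eviIter c g Pl (i + 1) - eviIter c g Pl i‖ ≤ prec} j ∧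
    v = eviIter c g Pl j

theorem EVIReturns.unique {c : S → A → ℝ} {g : S} {Pl : S → A → Set (S → ℝ)} {prec : ℝ}
    {v v' : S → ℝ} (h : EVIReturns c g Pl prec v) (h' : EVIReturns c g Pl prec v') : v = v' := by
  obtain ⟨j, hj, rfl⟩ := h
  obtain ⟨j', hj', rfl⟩ := h'
  rw [hj.unique hj']

end EVI

/-! ### The diameter estimation procedure -/

section Algorithm

variable {S A : Type*} [Fintype S] [Fintype A]

open Classical in
/-- The empirical transition probabilities from `(s, a)` after `n` calls of the generative model,
where `x s a i` is the next state returned by the `(i+1)`-st call at `(s, a)`. -/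
def empirical (x : S → A → ℕ → S) (n : ℕ) (s : S) (a : A) : S → ℝ :=
  fun s' => (((Finset.range n).filter fun i => x s a i = s').card : ℝ) / n

/-- The probability vectors at `ℓ¹` distance at most `η` from the empirical one. -/
def plausible (x : S → A → ℕ → S) (n : ℕ) (η : ℝ) (s : S) (a : A) : Set (S → ℝ) :=
  {q | q ∈ stdSimplex ℝ S ∧ ∑ s', |q s' - empirical x n s a s'| ≤ η}

/-- The program variables of the procedure. -/
structure EstState (S A : Type*) where
  /-- the guess `W` that is doubled -/
  W : ℝ
  /-- the accuracy `η` of the last iteration -/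
  η : ℝ
  /-- the value `ṽ_∞` found in the last iteration -/
  vInf : ℝ
  /-- the number of calls of the generative model at each state-action pair so far -/
  visits : S → A → ℕ
  /-- the total number of calls of the generative model so far -/
  calls : ℕ

/-- The initial state: `W = 1/2`, `ṽ_∞ = 1`, no call made (`η` is set before it is read). -/
def EstState.init (S A : Type*) : EstState S A where
  W := 1 / 2
  η := 0
  vInf := 1
  visits := fun _ _ => 0
  calls := 0

/-- One iteration of the while loop, run with parameters `ε`, `δ` on the answers `x` of the generative
model: it is entered when `ṽ_∞ > W`; it doubles `W`, sets `η = ε/(4W)`, `N = N(δ, η)`, calls the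
generative model until each pair has `N` visits, runs `EVI-SSP` with unit costs and precision
`min(1, ε)/2` for every goal state `g` (with output `v g`), and sets
`ṽ_∞ = max_g max_{s ≠ g} v g s`. There is no successor state when some run of `EVI-SSP` does not
stop. -/
def Iteration (ε δ : ℝ) (x : S → A → ℕ → S) (st st' : EstState S A) : Prop :=
  st.W < st.vInf ∧
  st'.W = 2 * st.W ∧
  st'.η = ε / (4 * st'.W) ∧
  (∀ s a, st'.visits s a =
    max (st.visits s a) (sampleSize (Fintype.card S) (Fintype.card A) δ st'.η)) ∧
  st'.calls = st.calls + ∑ s, ∑ a, (st'.visits s a - st.visits s a) ∧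
  ∃ v : S → S → ℝ,
    (∀ g, EVIReturns (fun (_ : S) (_ : A) => (1 : ℝ)) g
      (plausible x (sampleSize (Fintype.card S) (Fintype.card A) δ st'.η) st'.η)
      (min 1 ε / 2) (v g)) ∧
    st'.vInf = ⨆ gs : {gs : S × S // gs.2 ≠ gs.1}, v gs.1.1 gs.1.2

/-- The procedure, run with parameters `ε`, `δ` on the answers `x` of the generative model, terminates
after `τ` calls in total and returns the estimate `Dhat`. -/
def Returns (ε δ : ℝ) (x : S → A → ℕ → S) (Dhat : ℝ) (τ : ℕ) : Prop :=
  ∃ st : EstState S A,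
    Relation.ReflTransGen (Iteration ε δ x) (EstState.init S A) st ∧ st.vInf ≤ st.W ∧
    Dhat = (1 + 2 * st.η * (1 + ε) * st.vInf) * (1 + ε) * st.vInf ∧
    τ = st.calls

theorem Iteration.unique {ε δ : ℝ} {x : S → A → ℕ → S} {st st₁ st₂ : EstState S A}
    (h₁ : Iteration ε δ x st st₁) (h₂ : Iteration ε δ x st st₂) : st₁ = st₂ := by
  obtain ⟨W₁, η₁, V₁, n₁, c₁⟩ := st₁
  obtain ⟨W₂, η₂, V₂, n₂, c₂⟩ := st₂
  obtain ⟨-, hW₁, hη₁, hn₁, hc₁, v₁, hv₁, hV₁⟩ := h₁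
  obtain ⟨-, hW₂, hη₂, hn₂, hc₂, v₂, hv₂, hV₂⟩ := h₂
  dsimp only at *
  obtain rfl : W₁ = W₂ := hW₁.trans hW₂.symm
  obtain rfl : η₁ = η₂ := hη₁.trans hη₂.symm
  obtain rfl : n₁ = n₂ := by
    funext s a
    rw [hn₁, hn₂]
  obtain rfl : c₁ = c₂ := hc₁.trans hc₂.symm
  obtain rfl : v₁ = v₂ := funext fun g => (hv₁ g).unique (hv₂ g)
  rw [hV₁, hV₂]

/-- The procedure is deterministic: the answers of the generative model determine its estimate and
the number of calls. -/
theorem Returns.unique {ε δ : ℝ} {x : S → A → ℕ → S} {D₁ D₂ : ℝ} {τ₁ τ₂ : ℕ}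
    (h₁ : Returns ε δ x D₁ τ₁) (h₂ : Returns ε δ x D₂ τ₂) : D₁ = D₂ ∧ τ₁ = τ₂ := by
  obtain ⟨s₁, hr₁, hs₁, rfl, rfl⟩ := h₁
  obtain ⟨s₂, hr₂, hs₂, rfl, rfl⟩ := h₂
  have key : ∀ {s t : EstState S A}, s.vInf ≤ s.W →
      Relation.ReflTransGen (Iteration ε δ x) s t → s = t := by
    intro s t hs h
    rcases Relation.ReflTransGen.cases_head h with h | ⟨u, hu, -⟩
    · exact h
    · exact absurd hu.1 (not_lt.2 hs)
  have : s₁ = s₂ := by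
    rcases Relation.ReflTransGen.total_of_right_unique (r := Iteration ε δ x)
      (fun _ _ _ h h' => Iteration.unique h h') hr₁ hr₂ with h | h
    · exact key hs₁ h
    · exact (key hs₂ h).symm
  subst this
  exact ⟨rfl, rfl⟩

end Algorithm

end DiameterEstimation

end

/-! Randomness enters through a single event: every empirical law is within `confWidth` of the true
law, at all sample sizes simultaneously. It has probability at least 1 - δ, and on it the rest is
deterministic.

For this event, the Laplace predictor is a probability law on words, so its ratio to the true
likelihood of the sample is a nonnegative supermartingale started at 1. By Ville's inequality it
ever reaches K = SA/δ with probability at most 1/K (`measure_exceed_le`). While it stays below K,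
comparing the predictor with the maximum likelihood (`prod_pow_le_choose_mul_laplaceProb`) bounds n
times the relative entropy of the empirical law with respect to the true one, and Pinsker's
inequality turns this into an ℓ¹ bound (`sum_abs_sub_le_sqrt`).

On the event the true law is plausible. The optimal hitting times are then a supersolution of the
optimistic Bellman operator (`exists_bellman_supersolution`), so value iteration stops and its
values are at most D (`eviIter_le`). Conversely, let M be the largest value returned. The stopping
rule and the ℓ¹ radius make the greedy action decrease the value, in the true MDP, by at least c = 1
- ε/2 - ηM on average (`EVIReturns.exists_progress`), and a drift argument gives D ≤ M/c
(`diameter_toReal_le_div`).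

At exit M ≤ W and η = ε/(4W), so ηM ≤ ε/4 and c > 0; the formula for the estimate compensates the
division by c (`le_estimate`). The loop is entered only while W < D, so W doubles finitely often and
η never falls below ε/(8D), which bounds the number of calls. -/

namespace DiameterEstimation

/-! ### Pinsker's inequality for finite distributions -/

section Pinsker

/-- A quadratic lower bound for the integrand of the relative entropy. -/
theorem sq_div_le_mul_log_sub {x : ℝ} (hx : 0 < x) :
    3 * (x - 1) ^ 2 / (2 * (x + 2)) ≤ x * Real.log x - x + 1 := by
  -- `x * g x` is the difference of the two sides. The derivative of `g` has the sign of y - 1, so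
  -- `g` is minimal at 1, where it vanishes.
  set g : ℝ → ℝ := fun y => Real.log y - (5 * y ^ 2 - 4 * y - 1) / (2 * y ^ 2 + 4 * y) with hg
  have hder : ∀ y : ℝ, 0 < y →
      HasDerivAt g (4 * (y - 1) ^ 3 / (2 * y ^ 2 + 4 * y) ^ 2) y := by
    intro y hy
    have hne : 2 * y ^ 2 + 4 * y ≠ 0 := by positivity
    have h1 : HasDerivAt (fun y : ℝ => 5 * y ^ 2 - 4 * y - 1) (10 * y - 4) y := by
      have := (((hasDerivAt_id y).pow 2).const_mul 5).sub ((hasDerivAt_id y).const_mul 4)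
      convert! this.sub_const 1 using 1
      simp; ring
    have h2 : HasDerivAt (fun y : ℝ => 2 * y ^ 2 + 4 * y) (4 * y + 4) y := by
      have := (((hasDerivAt_id y).pow 2).const_mul 2).add ((hasDerivAt_id y).const_mul 4)
      convert! this using 1
      simp; ring
    convert! (Real.hasDerivAt_log hy.ne').sub (h1.div h2 hne) using 1
    field_simp
    ring
  have hg1 : g 1 = 0 := by norm_num [hg]
  have hgx : 0 ≤ g x := by
    rw [← hg1]
    rcases le_total 1 x with h | h
    · refine monotoneOn_of_deriv_nonneg (convex_Ici 1)
        (fun y hy => (hder y (by linarith [Set.mem_Ici.1 hy])).continuousAt.continuousWithinAt)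
        ?_ ?_ (Set.mem_Ici.2 le_rfl) h h
      · intro y hy
        rw [interior_Ici] at hy
        exact (hder y (by linarith [Set.mem_Ioi.1 hy])).differentiableAt.differentiableWithinAt
      · intro y hy
        rw [interior_Ici] at hy
        have hy' := Set.mem_Ioi.1 hy
        rw [(hder y (by linarith)).deriv]
        have : 0 ≤ (y - 1) ^ 3 := pow_nonneg (by linarith) 3
        positivity
    · refine antitoneOn_of_deriv_nonpos (convex_Ioc 0 1)
        (fun y hy => (hder y hy.1).continuousAt.continuousWithinAt)
        ?_ ?_ ⟨hx, h⟩ ⟨one_pos, le_rfl⟩ h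
      · intro y hy
        exact (hder y (interior_subset hy).1).differentiableAt.differentiableWithinAt
      · intro y hy
        have hy' := interior_subset hy
        rw [(hder y hy'.1).deriv]
        have : (y - 1) ^ 3 ≤ 0 := Odd.pow_nonpos (by decide) (by linarith [hy'.2])
        exact div_nonpos_of_nonpos_of_nonneg (by linarith) (by positivity)
  have hmul : 0 ≤ x * g x := mul_nonneg hx.le hgx
  have : x * g x = x * Real.log x - x + 1 - 3 * (x - 1) ^ 2 / (2 * (x + 2)) := by
    simp only [hg]
    field_simp
    ring
  linarith

theorem sq_div_le_mul_log_sub' {x : ℝ} (hx : 0 ≤ x) :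
    3 * (x - 1) ^ 2 / (2 * (x + 2)) ≤ x * Real.log x - x + 1 := by
  rcases hx.eq_or_lt with rfl | hx
  · norm_num
  · exact sq_div_le_mul_log_sub hx

/-- **Pinsker's inequality** for finite distributions, `q` being absolutely continuous with respect
to `p`. -/
theorem sq_sum_abs_sub_le {S : Type*} [Fintype S] (p q : S → ℝ) (hp : ∀ s, 0 ≤ p s)
    (hq : ∀ s, 0 ≤ q s) (hp1 : ∑ s, p s = 1) (hq1 : ∑ s, q s = 1)
    (hac : ∀ s, p s = 0 → q s = 0) :
    (∑ s, |p s - q s|) ^ 2 ≤ 2 * ∑ s, q s * Real.log (q s / p s) := by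
  -- Cauchy–Schwarz with weights whose product is (p - q)². The first factor is controlled by the
  -- scalar bound, and the second sums to 2/3 + 4/3 = 2, the constant in Pinsker's inequality.
  have hcs := Finset.sum_sq_le_sum_mul_sum_of_sq_le_mul Finset.univ
    (r := fun s => |p s - q s|)
    (f := fun s => p s * (3 * (q s / p s - 1) ^ 2 / (2 * (q s / p s + 2))))
    (g := fun s => p s * (2 * (q s / p s + 2) / 3))
    (fun s _ => mul_nonneg (hp s) (by have := div_nonneg (hq s) (hp s); positivity))
    (fun s _ => mul_nonneg (hp s) (by have := div_nonneg (hq s) (hp s); positivity))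
    (by
      intro s _
      refine le_of_eq ?_
      rw [sq_abs]
      rcases (hp s).eq_or_lt with h | h
      · simp [← h, hac s h.symm]
      · have : 0 ≤ q s / p s := div_nonneg (hq s) (hp s)
        have h2 : q s = p s * (q s / p s) := by field_simp
        set x := q s / p s
        rw [h2]
        have : x + 2 ≠ 0 := by positivity
        field_simp
        ring)
  have hg : ∑ s, p s * (2 * (q s / p s + 2) / 3) = 2 := by
    have : ∀ s, p s * (2 * (q s / p s + 2) / 3) = 2 / 3 * q s + 4 / 3 * p s := by
      intro s
      rcases eq_or_ne (p s) 0 with h | h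
      · simp [h, hac s h]
      · field_simp
        ring
    simp_rw [this, Finset.sum_add_distrib, ← Finset.mul_sum, hp1, hq1]
    norm_num
  have hf : ∑ s, p s * (3 * (q s / p s - 1) ^ 2 / (2 * (q s / p s + 2))) ≤
      ∑ s, q s * Real.log (q s / p s) := by
    -- The added terms 1 - q/p have mean zero under `p`.
    have : ∑ s, q s * Real.log (q s / p s) =
        ∑ s, p s * (q s / p s * Real.log (q s / p s) - q s / p s + 1) := by
      have h : ∀ s, p s * (q s / p s * Real.log (q s / p s) - q s / p s + 1) =
          q s * Real.log (q s / p s) - q s + p s := by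
        intro s
        rcases eq_or_ne (p s) 0 with h | h
        · simp [h, hac s h]
        · field_simp
      simp_rw [h, Finset.sum_add_distrib, Finset.sum_sub_distrib, hp1, hq1]
      ring
    rw [this]
    exact Finset.sum_le_sum fun s _ => mul_le_mul_of_nonneg_left
      (sq_div_le_mul_log_sub' (div_nonneg (hq s) (hp s))) (hp s)
  rw [hg] at hcs
  linarith

end Pinsker

/-! ### A time-uniform deviation bound for empirical distributions

The Laplace predictor is the mixture of all product laws with respect to the uniform prior; the
probability that it ever exceeds `c` times the true law is at most `1 / c`. -/

section Laplace

variable {S : Type*}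

open Classical in
/-- The number of occurrences of `i` among `x 0, …, x (n - 1)`. -/
noncomputable def letterCount (x : ℕ → S) (n : ℕ) (i : S) : ℕ :=
  ((Finset.range n).filter fun k => x k = i).card

theorem letterCount_congr {x y : ℕ → S} {n : ℕ} (h : ∀ k < n, x k = y k) :
    letterCount x n = letterCount y n := by
  classical
  funext i
  unfold letterCount
  congr 1
  exact Finset.filter_congr fun k hk => by rw [h k (Finset.mem_range.1 hk)]

open Classical in
theorem letterCount_update_succ (x : ℕ → S) (n : ℕ) (i : S) :
    letterCount (Function.update x n i) (n + 1) =
      Function.update (letterCount x n) i (letterCount x n i + 1) := by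
  funext j
  have h : letterCount (Function.update x n i) n = letterCount x n :=
    letterCount_congr fun k hk => Function.update_of_ne hk.ne _ _
  have h2 : letterCount (Function.update x n i) (n + 1) j =
      letterCount (Function.update x n i) n j + if i = j then 1 else 0 := by
    unfold letterCount
    rw [Finset.range_add_one, Finset.filter_insert]
    by_cases hij : i = j
    · simp [hij]
    · simp [hij]
  rw [h2, h]
  by_cases hij : j = i
  · subst hij; simp
  · simp [hij, Ne.symm hij]

variable [Fintype S]

theorem sum_letterCount (x : ℕ → S) (n : ℕ) : ∑ i, letterCount x n i = n := by
  classical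
  have := Finset.card_eq_sum_card_fiberwise (f := x) (s := Finset.range n) (t := Finset.univ)
    (fun _ _ => by simp)
  rw [Finset.card_range] at this
  unfold letterCount
  convert this.symm using 3

/-- The probability that the Laplace predictor gives to a word with letter counts `c`. -/
noncomputable def laplaceProb (c : S → ℕ) : ℝ :=
  ((Fintype.card S - 1).factorial * ∏ i, (c i).factorial : ℕ) /
    ((∑ i, c i + (Fintype.card S - 1)).factorial : ℕ)

theorem laplaceProb_nonneg (c : S → ℕ) : 0 ≤ laplaceProb c := by
  unfold laplaceProb; positivity

-- After counts `c` of total n, the predictor gives letter `i` the conditional probability (c i +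
-- 1)/(n + S), and these sum to 1. This consistency is the martingale property behind the maximal
-- inequality.
open Classical in
theorem sum_laplaceProb_update [Nonempty S] (c : S → ℕ) :
    ∑ i, laplaceProb (Function.update c i (c i + 1)) = laplaceProb c := by
  have hS : 0 < Fintype.card S := Fintype.card_pos
  have key : ∀ i, laplaceProb (Function.update c i (c i + 1)) =
      laplaceProb c * ((c i + 1 : ℝ) / ((∑ i, c i : ℕ) + Fintype.card S)) := by
    intro i
    have h1 : ∏ j, (Function.update c i (c i + 1) j).factorial =
        (c i + 1) * ∏ j, (c j).factorial := by
      rw [← Finset.mul_prod_erase _ _ (Finset.mem_univ i),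
        ← Finset.mul_prod_erase Finset.univ (fun j => (c j).factorial) (Finset.mem_univ i),
        Function.update_self, Nat.factorial_succ, mul_assoc]
      congr 2
      exact Finset.prod_congr rfl fun j hj => by
        rw [Function.update_of_ne (Finset.ne_of_mem_erase hj)]
    have h2 : ∑ j, Function.update c i (c i + 1) j = ∑ j, c j + 1 := by
      rw [← Finset.add_sum_erase _ _ (Finset.mem_univ i),
        ← Finset.add_sum_erase Finset.univ c (Finset.mem_univ i), Function.update_self]
      have : ∑ j ∈ Finset.univ.erase i, Function.update c i (c i + 1) j =
          ∑ j ∈ Finset.univ.erase i, c j :=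
        Finset.sum_congr rfl fun j hj => by
          rw [Function.update_of_ne (Finset.ne_of_mem_erase hj)]
      omega
    unfold laplaceProb
    rw [h1, h2, show ∑ j, c j + 1 + (Fintype.card S - 1) =
      (∑ j, c j + (Fintype.card S - 1)) + 1 by omega, Nat.factorial_succ,
      show ∑ j, c j + (Fintype.card S - 1) + 1 = ∑ j, c j + Fintype.card S by omega]
    push_cast
    have : (((∑ j, c j + (Fintype.card S - 1)).factorial : ℕ) : ℝ) ≠ 0 := by positivity
    have h3 : (∑ j, (c j : ℝ) + Fintype.card S) ≠ 0 := by positivity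
    field_simp
  simp_rw [key, ← Finset.mul_sum, ← Finset.sum_div]
  rw [Finset.sum_add_distrib]
  have h3 : (∑ j, (c j : ℝ) + Fintype.card S) ≠ 0 := by positivity
  simp [div_self h3]

/-- The Laplace predictor dominates the maximum likelihood up to a polynomial factor. -/
theorem prod_pow_le_choose_mul_laplaceProb (c : S → ℕ) :
    ∏ i, ((c i : ℝ) / (∑ j, c j : ℕ)) ^ c i ≤
      ((∑ j, c j + (Fintype.card S - 1)).choose (Fintype.card S - 1) : ℝ) * laplaceProb c := by
  classical
  set n := ∑ j, c j with hn
  set m := Fintype.card S - 1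
  -- Expand (∑ c i)ⁿ = nⁿ by the multinomial theorem and keep only the term with exponents `c`. The
  -- binomial factor turns `laplaceProb c` into the inverse of that multinomial coefficient.
  have hmul := Finset.sum_pow_eq_sum_piAntidiag (Finset.univ : Finset S) (fun i => (c i : ℝ)) n
  have hle : (Nat.multinomial Finset.univ c : ℝ) * ∏ i, (c i : ℝ) ^ c i ≤ (n : ℝ) ^ n := by
    have h1 : (∑ i, (c i : ℝ)) = n := by rw [hn]; push_cast; rfl
    rw [h1] at hmul
    rw [hmul]
    refine Finset.single_le_sum
      (f := fun k : S → ℕ => (Nat.multinomial Finset.univ k : ℝ) * ∏ i, (c i : ℝ) ^ k i)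
      (fun k _ => by positivity) ?_
    simp [Finset.mem_piAntidiag, hn]
  have hspec := Nat.multinomial_spec Finset.univ c
  have hch := Nat.add_choose_mul_factorial_mul_factorial n m
  have hlap : (((n + m).choose m : ℕ) : ℝ) * laplaceProb c =
      (∏ i, (c i).factorial : ℕ) / (n.factorial : ℝ) := by
    unfold laplaceProb
    rw [← hn, ← hch]
    have h1 : (((n + m).choose m : ℕ) : ℝ) ≠ 0 := by
      exact_mod_cast (Nat.choose_pos (Nat.le_add_left m n)).ne'
    push_cast
    have h2 : (((Fintype.card S - 1).factorial : ℕ) : ℝ) ≠ 0 := by positivity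
    change _ = (∏ i, ((c i).factorial : ℝ)) / n.factorial
    rw [show (m.factorial : ℝ) = (Fintype.card S - 1).factorial from rfl]
    field_simp
  rw [hlap]
  have hprod : ∏ i, ((c i : ℝ) / (n : ℕ)) ^ c i = (∏ i, (c i : ℝ) ^ c i) / (n : ℝ) ^ n := by
    simp_rw [div_pow, Finset.prod_div_distrib]
    rw [Finset.prod_pow_eq_pow_sum]
  rw [hprod]
  have hn0 : (0 : ℝ) < (n : ℝ) ^ n := by
    rcases Nat.eq_zero_or_pos n with h | h
    · simp [h]
    · positivity
  rw [div_le_div_iff₀ hn0 (by positivity)]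
  have hspec' : ((∏ i, (c i).factorial : ℕ) : ℝ) * (Nat.multinomial Finset.univ c : ℝ) =
      n.factorial := by exact_mod_cast hspec
  rw [← hspec', mul_left_comm]
  refine mul_le_mul_of_nonneg_left ?_ (by positivity)
  rw [mul_comm]
  exact hle

/-- The binomial coefficient is at most (n + m)^m / m!, and m^m / m! is one term of the series of
e^m. -/
theorem choose_add_le_pow (n m : ℕ) (hm : 0 < m) :
    ((n + m).choose m : ℝ) ≤ (Real.exp 1 * (1 + n / m)) ^ m := by
  have h1 : ((n + m).choose m : ℝ) ≤ ((n + m : ℕ) : ℝ) ^ m / m.factorial :=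
    Nat.choose_le_pow_div m (n + m)
  have h2 := Real.pow_div_factorial_le_exp (x := (m : ℝ)) (by positivity) m
  have hm' : (0 : ℝ) < m := by exact_mod_cast hm
  calc ((n + m).choose m : ℝ) ≤ ((n + m : ℕ) : ℝ) ^ m / m.factorial := h1
    _ = (1 + n / m : ℝ) ^ m * ((m : ℝ) ^ m / m.factorial) := by
        rw [show (1 + n / m : ℝ) = (n + m : ℕ) / (m : ℝ) by push_cast; field_simp; ring,
          div_pow]
        field_simp
    _ ≤ (1 + n / m : ℝ) ^ m * Real.exp m := by gcongr
    _ = _ := by rw [mul_pow, ← Real.exp_nat_mul, mul_one, mul_comm]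

/-- If the Laplace predictor is less than `K` times the law `p` on a sample, then the empirical
distribution is close to `p`. -/
theorem sum_abs_sub_le_sqrt [Nontrivial S] (p : S → ℝ) (hp : ∀ s, 0 ≤ p s) (hp1 : ∑ s, p s = 1)
    (c : S → ℕ) (n : ℕ) (hn : 0 < n) (hc : ∑ i, c i = n) {K : ℝ} (hK : 0 < K)
    (h : laplaceProb c < K * ∏ i, p i ^ c i) :
    ∑ s, |p s - (c s : ℝ) / n| ≤ √((2 * Real.log K + 2 * ((Fintype.card S : ℝ) - 1) *
      Real.log (Real.exp 1 * (1 + n / ((Fintype.card S : ℝ) - 1)))) / n) := by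
  have hS : 1 < Fintype.card S := Fintype.one_lt_card
  obtain ⟨m, hm⟩ : ∃ m, Fintype.card S = m + 1 := ⟨Fintype.card S - 1, by omega⟩
  have hm0 : 0 < m := by omega
  have hn' : (0 : ℝ) < n := by exact_mod_cast hn
  -- The strict inequality in `h` excludes a sample of probability zero, which yields the absolute
  -- continuity that Pinsker's inequality needs.
  have hppos : 0 < ∏ i, p i ^ c i := by
    have := (laplaceProb_nonneg c).trans_lt h
    exact pos_of_mul_pos_right this hK.le
  have hac : ∀ s, p s = 0 → c s = 0 := by
    intro s hs
    by_contra hcs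
    exact hppos.ne' (Finset.prod_eq_zero (Finset.mem_univ s) (by rw [hs, zero_pow hcs]))
  have hpin := sq_sum_abs_sub_le p (fun s => (c s : ℝ) / n) hp (fun s => by positivity) hp1
    (by rw [← Finset.sum_div, ← Nat.cast_sum, hc, div_self hn'.ne'])
    (fun s hs => by simp [hac s hs])
  refine Real.le_sqrt_of_sq_le (hpin.trans ?_)
  have hqpos : ∀ i, 0 < ((c i : ℝ) / n) ^ c i := by
    intro i
    rcases Nat.eq_zero_or_pos (c i) with h0 | h0
    · simp [h0]
    · positivity
  have hppos' : ∀ i, 0 < p i ^ c i := by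
    intro i
    rcases Nat.eq_zero_or_pos (c i) with h0 | h0
    · simp [h0]
    · exact pow_pos ((hp i).lt_of_ne fun hi => h0.ne' (hac i hi.symm)) _
  -- n times the relative entropy is the log-ratio of the maximum likelihood to the true likelihood.
  have hsum : ∑ s, (c s : ℝ) / n * Real.log ((c s : ℝ) / n / p s) =
      (Real.log (∏ i, ((c i : ℝ) / n) ^ c i) - Real.log (∏ i, p i ^ c i)) / n := by
    rw [Real.log_prod fun i _ => (hqpos i).ne', Real.log_prod fun i _ => (hppos' i).ne',
      ← Finset.sum_sub_distrib, Finset.sum_div]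
    refine Finset.sum_congr rfl fun s _ => ?_
    rcases Nat.eq_zero_or_pos (c s) with h0 | h0
    · simp [h0]
    · have hps : p s ≠ 0 := fun hs => h0.ne' (hac s hs)
      rw [Real.log_div (by positivity) hps, Real.log_pow, Real.log_pow]
      ring
  rw [hsum]
  have hML := prod_pow_le_choose_mul_laplaceProb c
  rw [hc, hm, Nat.add_sub_cancel] at hML
  have hch := choose_add_le_pow n m hm0
  have hE : 0 < Real.exp 1 * (1 + n / m : ℝ) := by positivity
  have hfin : ∏ i, ((c i : ℝ) / n) ^ c i ≤
      (Real.exp 1 * (1 + n / m)) ^ m * (K * ∏ i, p i ^ c i) :=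
    hML.trans (mul_le_mul hch h.le (laplaceProb_nonneg c) (by positivity))
  have hlog := Real.log_le_log (Finset.prod_pos fun i _ => hqpos i) hfin
  rw [Real.log_mul (by positivity) (by positivity), Real.log_mul hK.ne' hppos.ne',
    Real.log_pow] at hlog
  rw [hm, Nat.cast_add_one, add_sub_cancel_right, ← mul_div_assoc]
  gcongr
  linarith

end Laplace

/-! ### A maximal inequality for the Laplace predictor -/

section Deviation

variable {S : Type*} [Fintype S] [MeasurableSpace S] [MeasurableSingletonClass S]
  {Ω : Type*} [MeasurableSpace Ω] {μ : Measure Ω}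

theorem measureReal_cylinder (p : PMF S) (Y : ℕ → Ω → S)
    (hY : ∀ n, Measurable (Y n)) (hlaw : ∀ n, μ.map (Y n) = p.toMeasure) (hind : iIndepFun Y μ)
    (w : ℕ → S) (n : ℕ) :
    μ.real {ω | ∀ k < n, Y k ω = w k} = ∏ i, (p i).toReal ^ letterCount w n i := by
  classical
  have hset : {ω | ∀ k < n, Y k ω = w k} = ⋂ k ∈ Finset.range n, Y k ⁻¹' {w k} := by
    ext ω; simp
  have h1 : ∀ k, μ (Y k ⁻¹' {w k}) = p (w k) := by
    intro k
    rw [← Measure.map_apply (hY k) (measurableSet_singleton _), hlaw,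
      PMF.toMeasure_apply_singleton _ _ (measurableSet_singleton _)]
  rw [Measure.real, hset, hind.measure_inter_preimage_eq_mul (Finset.range n)
    (sets := fun k => {w k}) (fun k _ => measurableSet_singleton _)]
  simp_rw [h1]
  rw [ENNReal.toReal_prod, ← Finset.prod_fiberwise' (Finset.range n) w (fun s => (p s).toReal)]
  refine Finset.prod_congr rfl fun i _ => ?_
  rw [Finset.prod_const]
  unfold letterCount
  congr!

variable [IsProbabilityMeasure μ]

/-- Ville's inequality by induction on the remaining horizon `m`. If the word `w` has already
crossed the level, its cylinder has probability at most `laplaceProb` divided by `K`. Otherwise the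
cylinder splits according to the next letter, and consistency of the predictor adds up the bounds
for the longer words. -/
theorem mul_measureReal_exceed_le [Nonempty S] (p : PMF S) (Y : ℕ → Ω → S)
    (hY : ∀ n, Measurable (Y n)) (hlaw : ∀ n, μ.map (Y n) = p.toMeasure) (hind : iIndepFun Y μ)
    {K : ℝ} (hK : 0 < K) (m : ℕ) (w : ℕ → S) (n : ℕ) :
    K * μ.real ({ω | ∀ k < n, Y k ω = w k} ∩ {ω | ∃ k, n ≤ k ∧ k ≤ n + m ∧
      K * ∏ i, (p i).toReal ^ letterCount (fun j => Y j ω) k i ≤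
        laplaceProb (letterCount (fun j => Y j ω) k)}) ≤ laplaceProb (letterCount w n) := by
  classical
  induction m generalizing w n with
  | zero =>
    by_cases hb : K * ∏ i, (p i).toReal ^ letterCount w n i ≤ laplaceProb (letterCount w n)
    · refine le_trans (mul_le_mul_of_nonneg_left
        (measureReal_mono Set.inter_subset_left) hK.le) ?_
      rwa [measureReal_cylinder p Y hY hlaw hind]
    · convert laplaceProb_nonneg (letterCount w n)
      rw [mul_eq_zero]
      right
      convert measureReal_empty (μ := μ)
      rw [Set.eq_empty_iff_forall_notMem]
      rintro ω ⟨h1, k, hk1, hk2, hk3⟩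
      obtain rfl : k = n := by omega
      rw [letterCount_congr (y := w) h1] at hk3
      exact hb hk3
  | succ m ih =>
    by_cases hb : K * ∏ i, (p i).toReal ^ letterCount w n i ≤ laplaceProb (letterCount w n)
    · refine le_trans (mul_le_mul_of_nonneg_left
        (measureReal_mono Set.inter_subset_left) hK.le) ?_
      rwa [measureReal_cylinder p Y hY hlaw hind]
    · rw [← sum_laplaceProb_update]
      simp_rw [← letterCount_update_succ]
      refine le_trans ?_ (Finset.sum_le_sum fun i _ => ih (Function.update w n i) (n + 1))
      rw [← Finset.mul_sum]
      refine mul_le_mul_of_nonneg_left (le_trans (measureReal_mono ?_)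
        (measureReal_iUnion_fintype_le _)) hK.le
      rintro ω ⟨h1, k, hk1, hk2, hk3⟩
      refine Set.mem_iUnion.2 ⟨Y n ω, ?_, k, ?_, by omega, hk3⟩
      · intro j hj
        rcases Nat.lt_succ_iff_lt_or_eq.1 hj with hj | rfl
        · rw [h1 j hj, Function.update_of_ne hj.ne]
        · rw [Function.update_self]
      · rcases hk1.eq_or_lt with rfl | h
        · rw [letterCount_congr (y := w) h1] at hk3
          exact absurd hk3 hb
        · exact h

/-- With probability at least `1 - 1 / K`, the Laplace predictor never reaches `K` times the true
probability of the sample. -/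
theorem measure_exceed_le [Nonempty S] (p : PMF S) (Y : ℕ → Ω → S)
    (hY : ∀ n, Measurable (Y n)) (hlaw : ∀ n, μ.map (Y n) = p.toMeasure) (hind : iIndepFun Y μ)
    {K : ℝ} (hK : 0 < K) :
    μ {ω | ∃ k, K * ∏ i, (p i).toReal ^ letterCount (fun j => Y j ω) k i ≤
        laplaceProb (letterCount (fun j => Y j ω) k)} ≤ ENNReal.ofReal (1 / K) := by
  have hU : {ω | ∃ k, K * ∏ i, (p i).toReal ^ letterCount (fun j => Y j ω) k i ≤
        laplaceProb (letterCount (fun j => Y j ω) k)} =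
      ⋃ m : ℕ, {ω | ∃ k, k ≤ m ∧ K * ∏ i, (p i).toReal ^ letterCount (fun j => Y j ω) k i ≤
        laplaceProb (letterCount (fun j => Y j ω) k)} := by
    ext ω
    simp only [Set.mem_ofPred_eq, Set.mem_iUnion]
    exact ⟨fun ⟨k, hk⟩ => ⟨k, k, le_rfl, hk⟩, fun ⟨_, k, _, hk⟩ => ⟨k, hk⟩⟩
  rw [hU, Monotone.measure_iUnion]
  · refine iSup_le fun m => ?_
    -- Start from the empty word, whose predictor mass is 1; the letters of `w` are then irrelevant.
    have h := mul_measureReal_exceed_le p Y hY hlaw hind hK m (fun _ => Classical.arbitrary S) 0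
    have h0 : laplaceProb (letterCount (fun _ => Classical.arbitrary S) 0) = 1 := by
      have : letterCount (fun _ => Classical.arbitrary S) 0 = fun _ => 0 := by
        funext i; simp [letterCount]
      rw [this]
      simp [laplaceProb, div_self (Nat.cast_ne_zero (R := ℝ).2 (Nat.factorial_ne_zero _))]
    rw [h0, mul_comm, ← le_div_iff₀ hK] at h
    rw [← ofReal_measureReal]
    refine ENNReal.ofReal_le_ofReal (le_trans (le_of_eq ?_) h)
    congr 1
    ext ω
    simp
  · intro m m' hm ω
    rintro ⟨k, hk, hk'⟩
    exact ⟨k, hk.trans hm, hk'⟩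

end Deviation

/-! ### Union bound over state-action pairs -/

section Uniform

variable {S A : Type*} [Fintype S] [Nontrivial S] [Fintype A] [Nonempty A]
  [MeasurableSpace S] [MeasurableSingletonClass S]
  {Ω : Type*} [MeasurableSpace Ω] {μ : Measure Ω} [IsProbabilityMeasure μ]

/-- With probability at least `1 - δ`, all the empirical transition laws are within the confidence
width of the true ones at all times. -/
theorem ofReal_le_measure_confidence (P : S → A → PMF S) {δ : ℝ} (hδ : 0 < δ)
    (X : S → A → ℕ → Ω → S) (hX : ∀ s a n, Measurable (X s a n))
    (hlaw : ∀ s a n, μ.map (X s a n) = (P s a).toMeasure)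
    (hind : iIndepFun (fun i : S × A × ℕ => X i.1 i.2.1 i.2.2) μ) :
    ENNReal.ofReal (1 - δ) ≤ μ {ω | ∀ s a n, 0 < n →
      ∑ s', |(P s a s').toReal - empirical (fun s a n => X s a n ω) n s a s'| ≤
        confWidth (Fintype.card S) (Fintype.card A) δ n} := by
  classical
  -- Each pair may fail with probability 1/K = δ/(SA); log K is the first term inside `confWidth`.
  set K : ℝ := Fintype.card S * Fintype.card A / δ with hKdef
  have hSA : (0 : ℝ) < Fintype.card S * Fintype.card A := by
    have h1 : 0 < Fintype.card S := Fintype.card_pos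
    have h2 : 0 < Fintype.card A := Fintype.card_pos
    positivity
  have hK : 0 < K := div_pos hSA hδ
  set G := {ω | ∀ s a n, 0 < n →
      ∑ s', |(P s a s').toReal - empirical (fun s a n => X s a n ω) n s a s'| ≤
        confWidth (Fintype.card S) (Fintype.card A) δ n} with hG
  set B : S × A → Set Ω := fun sa =>
    {ω | ∃ k, K * ∏ i, (P sa.1 sa.2 i).toReal ^ letterCount (fun j => X sa.1 sa.2 j ω) k i ≤
        laplaceProb (letterCount (fun j => X sa.1 sa.2 j ω) k)} with hB
  have hsub : Gᶜ ⊆ ⋃ sa, B sa := by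
    intro ω hω
    by_contra hcon
    refine hω fun s a n hn => ?_
    have hnb : ω ∉ B (s, a) := fun h => hcon (Set.mem_iUnion.2 ⟨(s, a), h⟩)
    simp only [hB, Set.mem_ofPred_eq, not_exists, not_le] at hnb
    have hsum1 : ∑ s', ((P s a) s').toReal = 1 := by
      have h := (P s a).tsum_coe
      rw [tsum_fintype] at h
      rw [← ENNReal.toReal_sum fun i _ => (P s a).apply_ne_top i, h, ENNReal.toReal_one]
    exact sum_abs_sub_le_sqrt (fun s' => (P s a s').toReal) (fun _ => ENNReal.toReal_nonneg)
      hsum1 _ n hn (sum_letterCount _ n) hK (hnb n)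
  have hBsa : ∀ sa, μ (B sa) ≤ ENNReal.ofReal (1 / K) := by
    intro sa
    refine measure_exceed_le (P sa.1 sa.2) (fun n => X sa.1 sa.2 n) (hX _ _) (hlaw _ _) ?_ hK
    exact hind.precomp (g := fun n : ℕ => (sa.1, sa.2, n)) fun n n' h => by simpa using h
  have hbad : μ Gᶜ ≤ ENNReal.ofReal δ := by
    calc μ Gᶜ ≤ μ (⋃ sa, B sa) := measure_mono hsub
      _ ≤ ∑ sa, μ (B sa) := measure_iUnion_fintype_le _ _
      _ ≤ ∑ _sa : S × A, ENNReal.ofReal (1 / K) := Finset.sum_le_sum fun sa _ => hBsa sa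
      _ = ENNReal.ofReal δ := by
        rw [Finset.sum_const, ← ENNReal.ofReal_nsmul]
        congr 1
        simp only [Finset.card_univ, Fintype.card_prod, nsmul_eq_mul, Nat.cast_mul, hKdef]
        field_simp
  -- Subadditivity suffices here, so `G` need not be shown measurable.
  have htot : 1 ≤ μ G + μ Gᶜ := by
    rw [← measure_univ (μ := μ), ← Set.union_compl_self G]
    exact measure_union_le _ _
  rw [ENNReal.ofReal_sub _ hδ.le, ENNReal.ofReal_one]
  exact tsub_le_iff_right.2 (htot.trans (by gcongr))

end Uniform

/-! ### Expected hitting times through the killed transition operator -/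

section HittingTime

variable {S A : Type*}

-- Tail-sum formula: the hitting time T counts the t = 0, …, T - 1 with no visit to `g` in 1, …, t.
-- The term t = 0 is always 1, since time 0 does not count as a visit.
open Classical in
theorem hittingTime_eq_tsum (g : S) (x : ℕ → S) :
    hittingTime g x = ∑' t : ℕ, if ∀ j, 0 < j → j ≤ t → x j ≠ g then 1 else 0 := by
  by_cases h : ∃ t, 0 < t ∧ x t = g
  · have hmin : ∀ t, (∀ j, 0 < j → j ≤ t → x j ≠ g) ↔ t ∈ Finset.range (Nat.find h) := by
      intro t
      rw [Finset.mem_range, Nat.lt_find_iff]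
      exact ⟨fun H m hm hm' => H m hm'.1 hm hm'.2, fun H j hj hjt hxj => H j hjt ⟨hj, hxj⟩⟩
    simp_rw [hmin]
    rw [tsum_eq_sum (s := Finset.range (Nat.find h)) (fun t ht => by simp only [ht, if_false])]
    rw [Finset.sum_congr rfl (g := fun _ => (1 : ℝ≥0∞)) (fun t ht => by simp only [ht, if_true])]
    rw [Finset.sum_const, Finset.card_range, nsmul_eq_mul, mul_one]
    unfold hittingTime
    refine le_antisymm
      (iInf₂_le (f := fun t (_ : 0 < t ∧ x t = g) => (t : ℝ≥0∞)) (Nat.find h) (Nat.find_spec h))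
      (le_iInf₂ fun t ht => ?_)
    exact_mod_cast Nat.find_min' h ht
  · push Not at h
    have hT : ∀ t, (∀ j, 0 < j → j ≤ t → x j ≠ g) ↔ True :=
      fun t => iff_true_intro fun j hj _ => h j hj
    simp only [hT, if_true, ENNReal.tsum_const_eq_top_of_ne_zero (one_ne_zero)]
    unfold hittingTime
    simp only [iInf_eq_top]
    exact fun t ht => absurd ht.2 (h t ht.1)

variable [Fintype S]

open Classical in
/-- The transition operator of the chain that follows `π` and is killed when it enters `g`. -/
noncomputable def killedStep (P : S → A → PMF S) (π : S → A) (g : S) (φ : S → ℝ≥0∞) (s : S) : ℝ≥0∞ :=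
  ∑ s', if s' = g then 0 else P s (π s) s' * φ s'

open Classical in
theorem killedStep_apply (P : S → A → PMF S) (π : S → A) (g : S) (φ : S → ℝ≥0∞) (s : S) :
    killedStep P π g φ s = ∑ s', if s' = g then 0 else P s (π s) s' * φ s' := rfl

variable [MeasurableSpace S] [MeasurableSingletonClass S]

theorem lintegral_toMeasure_eq_sum (p : PMF S) (f : S → ℝ≥0∞) :
    ∫⁻ y, f y ∂p.toMeasure = ∑ y, p y * f y := by
  rw [lintegral_fintype]
  refine Finset.sum_congr rfl fun y _ => ?_
  rw [PMF.toMeasure_apply_singleton _ _ (measurableSet_singleton y), mul_comm]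

theorem lintegral_trajLaw_frestrictLe (P : S → A → PMF S) (π : S → A) (s : S) (t : ℕ)
    (F : (Π _ : Finset.Iic t, S) → ℝ≥0∞) :
    ∫⁻ x, F (Preorder.frestrictLe (π := fun _ => S) t x) ∂(trajLaw P π s) =
      ∫⁻ h, F h ∂(Kernel.partialTraj (X := fun _ => S) (historyKernel P π) 0 t fun _ => s) := by
  rw [← Kernel.traj_map_frestrictLe_apply,
    lintegral_map Measurable.of_discrete (Preorder.measurable_frestrictLe t)]
  rfl

open Classical in
/-- The expectation of `φ` at time `t` on the event that `g` has not been visited so far. -/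
theorem lintegral_trajLaw_avoid (P : S → A → PMF S) (π : S → A) (g s : S) (t : ℕ)
    (φ : S → ℝ≥0∞) :
    ∫⁻ x, (if ∀ j, 0 < j → j ≤ t → x j ≠ g then φ (x t) else 0) ∂(trajLaw P π s) =
      (killedStep P π g)^[t] φ s := by
  induction t generalizing φ with
  | zero =>
    have h : ∀ x : ℕ → S, (if ∀ j, 0 < j → j ≤ 0 → x j ≠ g then φ (x 0) else 0) =
        (fun y : Π _ : Finset.Iic 0, S => φ (y ⟨0, Finset.mem_Iic.2 le_rfl⟩))
          (Preorder.frestrictLe 0 x) := by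
      intro x
      rw [if_pos (fun j hj hj' => absurd hj' (by omega))]
      rfl
    rw [(lintegral_congr h).trans (lintegral_trajLaw_frestrictLe P π s 0
      fun y => φ (y ⟨0, Finset.mem_Iic.2 le_rfl⟩)),
      Kernel.partialTraj_self, Kernel.id_apply, lintegral_dirac]
    rfl
  | succ t ih =>
    -- The last transition is peeled off: given the history up to t, `killedStep P π g φ` at x t is
    -- the conditional expectation of `φ (x (t + 1))` off `g`. Hence the induction generalizes `φ`.
    rw [Function.iterate_succ_apply, ← ih]
    let G : (Π _ : Finset.Iic t, S) × S → ℝ≥0∞ := fun z =>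
      if ∀ j (hj : 0 < j) (hjt : j ≤ t), z.1 ⟨j, Finset.mem_Iic.2 hjt⟩ ≠ g then
        (if z.2 = g then 0 else φ z.2) else 0
    have h1 : ∀ x : ℕ → S, (if ∀ j, 0 < j → j ≤ t + 1 → x j ≠ g then φ (x (t + 1)) else 0) =
        G (Preorder.frestrictLe t x, x (t + 1)) := by
      intro x
      by_cases ha : ∀ j, 0 < j → j ≤ t → x j ≠ g
      · by_cases hb : x (t + 1) = g
        · rw [if_neg (fun h => h (t + 1) (by omega) le_rfl hb)]
          simp only [G, hb, if_true, ite_self]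
        · rw [if_pos]
          · change _ = if _ then (if x (t + 1) = g then 0 else φ (x (t + 1))) else 0
            rw [if_pos, if_neg hb]
            exact ha
          · intro j hj hjt
            rcases hjt.eq_or_lt with rfl | h
            · exact hb
            · exact ha j hj (by omega)
      · rw [if_neg (fun h => ha fun j hj hjt => h j hj (by omega))]
        change _ = if _ then _ else _
        rw [if_neg]
        exact ha
    have h2 : ∀ x : ℕ → S, (if ∀ j, 0 < j → j ≤ t → x j ≠ g then killedStep P π g φ (x t) else 0) =
        (fun z => ∫⁻ y, G (z, y) ∂(historyKernel P π t z)) (Preorder.frestrictLe t x) := by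
      intro x
      change _ = ∫⁻ y, G (Preorder.frestrictLe t x, y) ∂((P (x t) (π (x t))).toMeasure)
      rw [lintegral_toMeasure_eq_sum]
      by_cases ha : ∀ j, 0 < j → j ≤ t → x j ≠ g
      · rw [if_pos ha]
        unfold killedStep
        refine Finset.sum_congr rfl fun y _ => ?_
        have hG : G (Preorder.frestrictLe t x, y) = if y = g then 0 else φ y := if_pos ha
        rw [hG]
        split_ifs <;> simp
      · rw [if_neg ha]
        refine (Finset.sum_eq_zero fun y _ => ?_).symm
        have hG : G (Preorder.frestrictLe t x, y) = 0 := if_neg ha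
        rw [hG, mul_zero]
    -- Markov property: the joint law of the history and the next state is the composition-product
    -- of the partial trajectory with `historyKernel`.
    rw [(lintegral_congr h2).trans (lintegral_trajLaw_frestrictLe P π s t
      fun z => ∫⁻ y, G (z, y) ∂(historyKernel P π t z)), lintegral_congr h1,
      trajLaw, ← lintegral_map (μ := Kernel.traj (X := fun _ => S) (historyKernel P π) 0 _)
      (f := G) Measurable.of_discrete (by fun_prop),
      ← Kernel.partialTraj_compProd_eq_map_traj (Nat.zero_le t),
      Measure.lintegral_compProd Measurable.of_discrete]

theorem expectedHittingTime_eq_tsum (P : S → A → PMF S) (π : S → A) (s g : S) :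
    expectedHittingTime P π s g = ∑' t, (killedStep P π g)^[t] (fun _ => 1) s := by
  classical
  unfold expectedHittingTime
  simp_rw [hittingTime_eq_tsum]
  rw [lintegral_tsum]
  · exact tsum_congr fun t => lintegral_trajLaw_avoid P π g s t (fun _ => 1)
  · intro t
    refine (Measurable.ite ?_ measurable_const measurable_const).aemeasurable
    have : {x : ℕ → S | ∀ j, 0 < j → j ≤ t → x j ≠ g} =
        ⋂ j, ⋂ (_ : 0 < j), ⋂ (_ : j ≤ t), (fun x : ℕ → S => x j) ⁻¹' {g}ᶜ := by
      ext x; simp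
    rw [this]
    exact MeasurableSet.iInter fun j => MeasurableSet.iInter fun _ => MeasurableSet.iInter fun _ =>
      measurable_pi_apply j (measurableSet_singleton g).compl

/-- First-step analysis. -/
theorem expectedHittingTime_eq_one_add (P : S → A → PMF S) (π : S → A) (s g : S) :
    expectedHittingTime P π s g =
      1 + killedStep P π g (fun s' => expectedHittingTime P π s' g) s := by
  rw [expectedHittingTime_eq_tsum, tsum_eq_zero_add' ENNReal.summable]
  simp_rw [expectedHittingTime_eq_tsum, Function.iterate_succ_apply', Function.iterate_zero, id]
  congr 1
  unfold killedStep
  rw [Summable.tsum_finsetSum fun _ _ => ENNReal.summable]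
  refine Finset.sum_congr rfl fun s' _ => ?_
  split_ifs
  · simp
  · rw [ENNReal.tsum_mul_left]


/-- A supersolution of the equation of first-step analysis bounds the expected hitting time. -/
theorem mul_expectedHittingTime_le (P : S → A → PMF S) (π : S → A) (g : S) (c : ℝ≥0∞)
    (v : S → ℝ≥0∞) (hv : ∀ s, s ≠ g → c + killedStep P π g v s ≤ v s) {s : S} (hs : s ≠ g) :
    c * expectedHittingTime P π s g ≤ v s := by
  rw [expectedHittingTime_eq_tsum, ← ENNReal.tsum_mul_left, ENNReal.tsum_eq_iSup_nat]
  refine iSup_le fun n => ?_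
  -- The partial sums satisfy σ₀ = 0 and σₙ₊₁ = c + `killedStep` σₙ, so monotonicity keeps them
  -- below the supersolution. The value of `v` at `g` is never used.
  induction n generalizing s with
  | zero => simp
  | succ n ih =>
    refine le_trans ?_ (hv s hs)
    rw [Finset.sum_range_succ']
    simp only [Function.iterate_succ_apply', Function.iterate_zero, id, mul_one]
    rw [add_comm]
    refine add_le_add le_rfl ?_
    simp only [killedStep_apply, Finset.mul_sum]
    rw [Finset.sum_comm]
    refine Finset.sum_le_sum fun s' _ => ?_
    split_ifs with h
    · simp
    · rw [show ∑ k ∈ Finset.range n, c * (P s (π s) s' *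
          (killedStep P π g)^[k] (fun _ => 1) s') =
          P s (π s) s' * ∑ k ∈ Finset.range n, c * (killedStep P π g)^[k] (fun _ => 1) s' by
        rw [Finset.mul_sum]
        exact Finset.sum_congr rfl fun k _ => mul_left_comm _ _ _]
      exact mul_le_mul_right (ih h) _

theorem iInf_expectedHittingTime_le_diameter (P : S → A → PMF S) {s g : S} (h : s ≠ g) :
    ⨅ π : S → A, expectedHittingTime P π s g ≤ diameter P :=
  le_trans (le_iSup (fun _ : s ≠ g => ⨅ π : S → A, expectedHittingTime P π s g) h)
    (le_trans (le_iSup (fun g => ⨆ _ : s ≠ g, ⨅ π : S → A, expectedHittingTime P π s g) g)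
      (le_iSup (fun s => ⨆ g, ⨆ _ : s ≠ g, ⨅ π : S → A, expectedHittingTime P π s g) s))

theorem diameter_lt_top (P : S → A → PMF S) (hP : Communicating P) : diameter P < ∞ := by
  unfold diameter
  have h : ∀ s g : S, ⨆ _ : s ≠ g, ⨅ π : S → A, expectedHittingTime P π s g < ∞ := by
    intro s g
    by_cases hs : s = g
    · simp [hs]
    · obtain ⟨π, hπ⟩ := hP s g hs
      rw [iSup_pos hs]
      exact (iInf_le _ π).trans_lt hπ
  rcases isEmpty_or_nonempty S with hS | hS
  · simp
  · obtain ⟨s, hs⟩ := exists_eq_ciSup_of_finite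
      (f := fun s : S => ⨆ g, ⨆ _ : s ≠ g, ⨅ π : S → A, expectedHittingTime P π s g)
    obtain ⟨g, hg⟩ := exists_eq_ciSup_of_finite
      (f := fun g : S => ⨆ _ : s ≠ g, ⨅ π : S → A, expectedHittingTime P π s g)
    rw [← hs, ← hg]
    exact h s g

theorem one_le_diameter [Nontrivial S] (P : S → A → PMF S) : 1 ≤ diameter P := by
  obtain ⟨s, g, h⟩ := exists_pair_ne S
  refine le_trans (le_iInf fun π => ?_) (iInf_expectedHittingTime_le_diameter P h)
  rw [expectedHittingTime_eq_one_add]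
  exact le_self_add

/-- The optimal expected hitting times of `g` are at most the diameter and satisfy the Bellman
inequality. -/
theorem exists_bellman_supersolution [Finite A] [Nonempty A] (P : S → A → PMF S)
    (hP : Communicating P) (g : S) :
    ∃ V : S → ℝ, (∀ s, 0 ≤ V s) ∧ V g = 0 ∧ (∀ s, V s ≤ (diameter P).toReal) ∧
      ∀ s, s ≠ g → ∃ a, 1 + ∑ s', (P s a s').toReal * V s' ≤ V s := by
  classical
  -- At `g` the value is set to 0, whereas `expectedHittingTime` from `g` would be a return time.
  set U : S → ℝ≥0∞ := fun s => if s = g then 0 else ⨅ π : S → A, expectedHittingTime P π s g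
    with hU
  have hD := diameter_lt_top P hP
  have hUD : ∀ s, U s ≤ diameter P := by
    intro s
    by_cases h : s = g
    · simp [hU, h]
    · simp only [hU, h, if_false]
      exact iInf_expectedHittingTime_le_diameter P h
  have hUfin : ∀ s, U s ≠ ∞ := fun s => ((hUD s).trans_lt hD).ne
  refine ⟨fun s => (U s).toReal, fun s => ENNReal.toReal_nonneg, by simp [hU],
    fun s => ENNReal.toReal_mono hD.ne (hUD s), fun s hs => ?_⟩
  -- A policy optimal from this one `s` suffices: after its first step, its hitting times dominate
  -- the infima at the successors. No policy optimal from all states is needed.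
  obtain ⟨π, hπ⟩ := exists_eq_ciInf_of_finite (f := fun π : S → A => expectedHittingTime P π s g)
  have hUs : U s = expectedHittingTime P π s g := by
    simp only [hU, hs, if_false]
    exact hπ.symm
  refine ⟨π s, ?_⟩
  have hle : 1 + ∑ s', P s (π s) s' * U s' ≤ U s := by
    rw [hUs, expectedHittingTime_eq_one_add]
    refine add_le_add le_rfl (Finset.sum_le_sum fun s' _ => ?_)
    by_cases h : s' = g
    · simp [hU, h]
    · simp only [hU, h, if_false]
      exact mul_le_mul_right (iInf_le _ π) _
  have hfin : ∀ s' ∈ Finset.univ, P s (π s) s' * U s' ≠ ∞ := fun s' _ =>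
    ENNReal.mul_ne_top ((P s (π s)).apply_ne_top s') (hUfin s')
  have := ENNReal.toReal_mono (hUfin s) hle
  rwa [ENNReal.toReal_add ENNReal.one_ne_top (ENNReal.sum_ne_top.2 hfin),
    ENNReal.toReal_sum hfin, ENNReal.toReal_one,
    Finset.sum_congr rfl fun s' _ => ENNReal.toReal_mul] at this

/-- If for every goal there is a value function at most `M` along which some policy makes a
progress `c` at every step, then the diameter is at most `M / c`. -/
theorem diameter_toReal_le_div [Nonempty A] (P : S → A → PMF S) {M c : ℝ} (hM : 0 ≤ M) (hc : 0 < c)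
    (h : ∀ g : S, ∃ v : S → ℝ, (∀ s, 0 ≤ v s) ∧ (∀ s, v s ≤ M) ∧
      ∀ s, s ≠ g → ∃ a, c + ∑ s', (P s a s').toReal * v s' ≤ v s) :
    (diameter P).toReal ≤ M / c := by
  classical
  refine ENNReal.toReal_le_of_le_ofReal (div_nonneg hM hc.le) ?_
  refine iSup_le fun s => iSup_le fun g => iSup_le fun hsg => ?_
  obtain ⟨v, hv0, hvM, hv⟩ := h g
  choose! π hπ using hv
  refine (iInf_le _ π).trans ?_
  have key := mul_expectedHittingTime_le P π g (ENNReal.ofReal c) (fun s => ENNReal.ofReal (v s))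
    (fun s hs => ?_) hsg
  · rw [ENNReal.ofReal_div_of_pos hc, ENNReal.le_div_iff_mul_le
      (Or.inl (ENNReal.ofReal_pos.2 hc).ne') (Or.inl ENNReal.ofReal_ne_top), mul_comm]
    exact key.trans (ENNReal.ofReal_le_ofReal (hvM s))
  · refine le_trans ?_ (ENNReal.ofReal_le_ofReal (hπ s hs))
    rw [ENNReal.ofReal_add hc.le (Finset.sum_nonneg fun s' _ =>
        mul_nonneg ENNReal.toReal_nonneg (hv0 s')),
      ENNReal.ofReal_sum_of_nonneg fun s' _ => mul_nonneg ENNReal.toReal_nonneg (hv0 s')]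
    refine add_le_add le_rfl (Finset.sum_le_sum fun s' _ => ?_)
    rw [ENNReal.ofReal_mul ENNReal.toReal_nonneg,
      ENNReal.ofReal_toReal ((P s (π s)).apply_ne_top s')]
    split_ifs
    · exact zero_le
    · exact le_rfl

end HittingTime

/-! ### Convergence and accuracy of extended value iteration -/

section ValueIteration

variable {S A : Type*} [Fintype S] {c : S → A → ℝ} {g : S} {Pl : S → A → Set (S → ℝ)}

theorem extBellman_goal (v : S → ℝ) : extBellman c g Pl v g = 0 := if_pos rfl

theorem extBellman_of_ne (v : S → ℝ) {s : S} (h : s ≠ g) : extBellman c g Pl v s =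
    ⨅ a : A, (c s a + sInf ((fun q : S → ℝ => ∑ s', q s' * v s') '' Pl s a)) := if_neg h

theorem sum_mul_nonneg_of_mem_stdSimplex {q v : S → ℝ} (hq : q ∈ stdSimplex ℝ S) (hv : 0 ≤ v) :
    0 ≤ ∑ s', q s' * v s' :=
  Finset.sum_nonneg fun s' _ => mul_nonneg (hq.1 s') (hv s')

theorem bddBelow_image_sum_mul {K : Set (S → ℝ)} (hK : K ⊆ stdSimplex ℝ S) {v : S → ℝ}
    (hv : 0 ≤ v) : BddBelow ((fun q : S → ℝ => ∑ s', q s' * v s') '' K) :=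
  ⟨0, by rintro _ ⟨q, hq, rfl⟩; exact sum_mul_nonneg_of_mem_stdSimplex (hK hq) hv⟩

theorem sInf_image_sum_mul_mono {K : Set (S → ℝ)} (hK : K ⊆ stdSimplex ℝ S) (hne : K.Nonempty)
    {v w : S → ℝ} (hv : 0 ≤ v) (hvw : v ≤ w) :
    sInf ((fun q : S → ℝ => ∑ s', q s' * v s') '' K) ≤
      sInf ((fun q : S → ℝ => ∑ s', q s' * w s') '' K) := by
  refine le_csInf (hne.image _) ?_
  rintro _ ⟨q, hq, rfl⟩
  exact csInf_le_of_le (bddBelow_image_sum_mul hK hv) ⟨q, hq, rfl⟩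
    (Finset.sum_le_sum fun s' _ => mul_le_mul_of_nonneg_left (hvw s') ((hK hq).1 s'))

/-- Two probability vectors at `ℓ¹` distance at most `2 η` give expectations of a function with
values in `[0, M]` that differ by at most `η M`. -/
theorem sum_mul_le_sum_mul_add {p q v : S → ℝ} {η M : ℝ} (hp : ∑ s, p s = 1) (hq : ∑ s, q s = 1)
    (hpq : ∑ s, |p s - q s| ≤ 2 * η) (hv0 : 0 ≤ v) (hvM : ∀ s, v s ≤ M) (hM : 0 ≤ M) :
    ∑ s, p s * v s ≤ ∑ s, q s * v s + η * M := by
  -- Since p - q sums to zero, `v` may be centred at M/2, which halves the Hölder constant.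
  have h1 : ∑ s, p s * v s - ∑ s, q s * v s = ∑ s, (p s - q s) * (v s - M / 2) := by
    have : ∑ s, (p s - q s) * (v s - M / 2) =
        ∑ s, p s * v s - ∑ s, q s * v s - (∑ s, p s - ∑ s, q s) * (M / 2) := by
      rw [← Finset.sum_sub_distrib, ← Finset.sum_sub_distrib, Finset.sum_mul,
        ← Finset.sum_sub_distrib]
      exact Finset.sum_congr rfl fun s _ => by ring
    rw [this, hp, hq]
    ring
  have h2 : ∑ s, (p s - q s) * (v s - M / 2) ≤ ∑ s, |p s - q s| * (M / 2) := by
    refine Finset.sum_le_sum fun s _ => (le_abs_self _).trans ?_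
    rw [abs_mul]
    refine mul_le_mul_of_nonneg_left (abs_le.2 ⟨?_, ?_⟩) (abs_nonneg _)
    · linarith [show 0 ≤ v s from hv0 s]
    · linarith [hvM s]
  rw [← Finset.sum_mul] at h2
  have h3 := mul_le_mul_of_nonneg_right hpq (by linarith : 0 ≤ M / 2)
  linarith

theorem eviIter_succ (j : ℕ) :
    eviIter c g Pl (j + 1) = extBellman c g Pl (eviIter c g Pl j) :=
  Function.iterate_succ_apply' _ _ _

theorem eviIter_goal (j : ℕ) : eviIter c g Pl j g = 0 := by
  cases j with
  | zero => rfl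
  | succ j => rw [eviIter_succ, extBellman_goal]

theorem extBellman_nonneg (hc : ∀ s a, 0 ≤ c s a) (hPl : ∀ s a, Pl s a ⊆ stdSimplex ℝ S)
    {v : S → ℝ} (hv : 0 ≤ v) : 0 ≤ extBellman c g Pl v := by
  intro s
  by_cases h : s = g
  · rw [h, extBellman_goal]; exact le_rfl
  · rw [extBellman_of_ne v h]
    refine Real.iInf_nonneg fun a => add_nonneg (hc s a) (Real.sInf_nonneg ?_)
    rintro _ ⟨q, hq, rfl⟩
    exact sum_mul_nonneg_of_mem_stdSimplex (hPl s a hq) hv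

theorem eviIter_nonneg (hc : ∀ s a, 0 ≤ c s a) (hPl : ∀ s a, Pl s a ⊆ stdSimplex ℝ S) (j : ℕ) :
    0 ≤ eviIter c g Pl j := by
  induction j with
  | zero => exact le_rfl
  | succ j ih => rw [eviIter_succ]; exact extBellman_nonneg hc hPl ih

variable [Finite A]

theorem extBellman_mono (hPl : ∀ s a, Pl s a ⊆ stdSimplex ℝ S) (hne : ∀ s a, (Pl s a).Nonempty)
    {v w : S → ℝ} (hv : 0 ≤ v) (hvw : v ≤ w) : extBellman c g Pl v ≤ extBellman c g Pl w := by
  intro s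
  by_cases h : s = g
  · rw [h, extBellman_goal, extBellman_goal]
  · rw [extBellman_of_ne v h, extBellman_of_ne w h]
    exact ciInf_mono (Set.finite_range _).bddBelow fun a =>
      add_le_add le_rfl (sInf_image_sum_mul_mono (hPl s a) (hne s a) hv hvw)

theorem eviIter_monotone (hc : ∀ s a, 0 ≤ c s a) (hPl : ∀ s a, Pl s a ⊆ stdSimplex ℝ S)
    (hne : ∀ s a, (Pl s a).Nonempty) : Monotone (eviIter c g Pl) := by
  refine monotone_nat_of_le_succ fun j => ?_
  induction j with
  | zero => exact eviIter_nonneg hc hPl 1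
  | succ j ih =>
    rw [eviIter_succ, eviIter_succ]
    exact extBellman_mono hPl hne (eviIter_nonneg hc hPl j) ih

/-- The iteration starts below `V` and its operator is monotone. Applied to the true optimal hitting
times, this gives both boundedness of the iterates and the upper bound D. -/
theorem eviIter_le (hc : ∀ s a, 0 ≤ c s a) (hPl : ∀ s a, Pl s a ⊆ stdSimplex ℝ S)
    (hne : ∀ s a, (Pl s a).Nonempty) {V : S → ℝ} (hV : 0 ≤ V) (hVB : extBellman c g Pl V ≤ V)
    (j : ℕ) : eviIter c g Pl j ≤ V := by
  induction j with
  | zero => exact hV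
  | succ j ih =>
    rw [eviIter_succ]
    exact (extBellman_mono hPl hne (eviIter_nonneg hc hPl j) ih).trans hVB

/-- Extended value iteration stops when its operator has a nonnegative supersolution. -/
theorem exists_EVIReturns (hc : ∀ s a, 0 ≤ c s a) (hPl : ∀ s a, Pl s a ⊆ stdSimplex ℝ S)
    (hne : ∀ s a, (Pl s a).Nonempty) {V : S → ℝ} (hV : 0 ≤ V) (hVB : extBellman c g Pl V ≤ V)
    {prec : ℝ} (hprec : 0 < prec) : ∃ v, EVIReturns c g Pl prec v := by
  have hmono := eviIter_monotone (g := g) hc hPl hne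
  have hlim : ∀ s, Filter.Tendsto (fun j => eviIter c g Pl j s) Filter.atTop
      (nhds (⨆ j, eviIter c g Pl j s)) := fun s =>
    tendsto_atTop_ciSup (fun i j hij => hmono hij s)
      ⟨V s, by rintro _ ⟨j, rfl⟩; exact eviIter_le hc hPl hne hV hVB j s⟩
  have hlim' := tendsto_pi_nhds.2 hlim
  -- The iterates increase and are bounded, so their increments tend to 0 in the sup norm of the
  -- finite-dimensional space; no contraction is involved.
  have hdiff := ((hlim'.comp (Filter.tendsto_add_atTop_nat 1)).sub hlim').norm
  rw [sub_self, norm_zero] at hdiff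
  obtain ⟨i, hi⟩ := (hdiff.eventually (ge_mem_nhds hprec)).exists
  have hset : {i : ℕ | ‖eviIter c g Pl (i + 1) - eviIter c g Pl i‖ ≤ prec}.Nonempty := ⟨i, hi⟩
  exact ⟨_, sInf _, ⟨Nat.sInf_mem hset, fun k hk => Nat.sInf_le hk⟩, rfl⟩

/-- At the value that extended value iteration returns, some action makes a progress
`c - prec - η M` in any model `p` at distance at most `2 η` from all plausible ones. -/
theorem EVIReturns.exists_progress [Nonempty A] {c₀ prec η M : ℝ} {v : S → ℝ}
    (h : EVIReturns (fun (_ : S) (_ : A) => c₀) g Pl prec v)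
    (hPl : ∀ s a, Pl s a ⊆ stdSimplex ℝ S) (hne : ∀ s a, (Pl s a).Nonempty)
    {p : S → A → S → ℝ} (hp : ∀ s a, p s a ∈ stdSimplex ℝ S)
    (hclose : ∀ s a, ∀ q ∈ Pl s a, ∑ s', |p s a s' - q s'| ≤ 2 * η)
    (hv0 : 0 ≤ v) (hvM : ∀ s, v s ≤ M) (hM : 0 ≤ M) {s : S} (hs : s ≠ g) :
    ∃ a, (c₀ - prec - η * M) + ∑ s', p s a s' * v s' ≤ v s := by
  obtain ⟨j, ⟨hj, -⟩, rfl⟩ := h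
  set v := eviIter (fun (_ : S) (_ : A) => c₀) g Pl j
  -- The stopping rule makes the output a supersolution up to `prec`. The action used is the greedy
  -- one in the optimistic model, and passing to `p` costs at most `η * M` against every plausible
  -- `q`.
  have h1 : extBellman (fun (_ : S) (_ : A) => c₀) g Pl v s ≤ v s + prec := by
    have := (norm_le_pi_norm (eviIter (fun (_ : S) (_ : A) => c₀) g Pl (j + 1) - v) s).trans hj
    rw [eviIter_succ, Pi.sub_apply, Real.norm_eq_abs] at this
    linarith [le_abs_self (extBellman (fun (_ : S) (_ : A) => c₀) g Pl v s - v s)]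
  rw [extBellman_of_ne v hs] at h1
  obtain ⟨a, ha⟩ := exists_eq_ciInf_of_finite
    (f := fun a : A => c₀ + sInf ((fun q : S → ℝ => ∑ s', q s' * v s') '' Pl s a))
  rw [← ha] at h1
  refine ⟨a, ?_⟩
  have h2 : ∑ s', p s a s' * v s' - η * M ≤
      sInf ((fun q : S → ℝ => ∑ s', q s' * v s') '' Pl s a) := by
    refine le_csInf ((hne s a).image _) ?_
    rintro _ ⟨q, hq, rfl⟩
    have := sum_mul_le_sum_mul_add (hp s a).2 (hPl s a hq).2 (hclose s a q hq) hv0 hvM hM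
    linarith
  linarith

end ValueIteration

/-! ### The diameter estimation procedure on accurate samples -/

section Procedure

variable {S A : Type*} [Fintype S] [Fintype A]

/-- With y = ηM, the claim reduces to (1 + 2(1 + ε)y)(1 + ε)(1 - ε/2 - y) ≥ 1. The left side is
concave in y and at least 1 at both ends y = 0 and y = ε/4 because ε ≤ 1; at ε = 1 both ends give
equality. -/
theorem le_estimate {ε η M D : ℝ} (hε : 0 < ε) (hε1 : ε ≤ 1) (hη : 0 ≤ η) (hM : 0 ≤ M)
    (hηM : η * M ≤ ε / 4) (hD : D ≤ M / (1 - ε / 2 - η * M)) :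
    D ≤ (1 + 2 * η * (1 + ε) * M) * (1 + ε) * M := by
  set y := η * M with hy
  have hy0 : 0 ≤ y := mul_nonneg hη hM
  have hpos : 0 < 1 - ε / 2 - y := by linarith
  refine hD.trans ?_
  rw [div_le_iff₀ hpos]
  have key : 1 ≤ (1 + 2 * (1 + ε) * y) * (1 + ε) * (1 - ε / 2 - y) := by
    nlinarith [mul_nonneg hy0 (sub_nonneg.2 hηM), mul_nonneg hε.le (sub_nonneg.2 hε1),
      mul_nonneg (mul_nonneg hε.le hε.le) (sub_nonneg.2 hε1),
      mul_nonneg hε.le (sub_nonneg.2 hηM), mul_nonneg hε.le hy0,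
      mul_nonneg (mul_nonneg hε.le hy0) (sub_nonneg.2 hηM),
      mul_nonneg (mul_nonneg hε.le (mul_nonneg hε.le hy0)) (sub_nonneg.2 hηM),
      mul_nonneg (mul_nonneg hε.le hy0) (sub_nonneg.2 hε1),
      mul_nonneg (mul_nonneg hε.le (mul_nonneg hε.le hy0)) (sub_nonneg.2 hε1)]
  calc M = M * 1 := (mul_one M).symm
    _ ≤ M * ((1 + 2 * (1 + ε) * y) * (1 + ε) * (1 - ε / 2 - y)) := by gcongr
    _ = _ := by rw [hy]; ring

theorem estimate_le {ε η M D : ℝ} (hε : 0 < ε) (hM : 0 ≤ M)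
    (hηM : η * M ≤ ε / 4) (hMD : M ≤ D) :
    (1 + 2 * η * (1 + ε) * M) * (1 + ε) * M ≤ (1 + ε * (1 + ε) / 2) * (1 + ε) * D := by
  have h : 2 * η * (1 + ε) * M ≤ ε * (1 + ε) / 2 := by nlinarith
  have h1 : (1 + 2 * η * (1 + ε) * M) * (1 + ε) ≤ (1 + ε * (1 + ε) / 2) * (1 + ε) := by gcongr
  exact mul_le_mul h1 hMD hM (by positivity)

/-- `sampleSize` decreases as the accuracy is relaxed. The witness is needed because the infimum of
an empty set of naturals is 0. -/
theorem sampleSize_spec {nS nA : ℕ} {δ η η' : ℝ} (h : η ≤ η')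
    (hne : ∃ n : ℕ, 0 < n ∧ confWidth nS nA δ n ≤ η) :
    0 < sampleSize nS nA δ η' ∧ confWidth nS nA δ (sampleSize nS nA δ η') ≤ η' ∧
      sampleSize nS nA δ η' ≤ sampleSize nS nA δ η := by
  have hmem : sampleSize nS nA δ η ∈ {n : ℕ | 0 < n ∧ confWidth nS nA δ n ≤ η} :=
    Nat.sInf_mem hne
  have hmem' : sampleSize nS nA δ η ∈ {n : ℕ | 0 < n ∧ confWidth nS nA δ n ≤ η'} :=
    ⟨hmem.1, hmem.2.trans h⟩
  have := Nat.sInf_mem ⟨_, hmem'⟩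
  exact ⟨this.1, this.2, Nat.sInf_le hmem'⟩

theorem PMF_toReal_mem_stdSimplex (p : PMF S) : (fun s => (p s).toReal) ∈ stdSimplex ℝ S := by
  refine ⟨fun s => ENNReal.toReal_nonneg, ?_⟩
  have h := p.tsum_coe
  rw [tsum_fintype] at h
  rw [← ENNReal.toReal_sum fun i _ => p.apply_ne_top i, h, ENNReal.toReal_one]

/-- What holds whenever the loop test is evaluated on accurate samples, `N` being an upper bound
for the number of samples per state-action pair. -/
structure LoopInvariant (ε D : ℝ) (N : ℕ) (st : EstState S A) : Prop where
  half_le_W : 1 / 2 ≤ st.W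
  visits_le : ∀ s a, st.visits s a ≤ N
  calls_eq : st.calls = ∑ s, ∑ a, st.visits s a
  vInf_le : st.vInf ≤ D
  vInf_nonneg : 0 ≤ st.vInf
  done : st.vInf ≤ st.W → st.η = ε / (4 * st.W) ∧ D ≤ st.vInf / (1 - ε / 2 - st.η * st.vInf)

theorem LoopInvariant.init {ε : ℝ} (D : ℝ) (hD : 1 ≤ D) (N : ℕ) :
    LoopInvariant ε D N (EstState.init S A) where
  half_le_W := le_rfl
  visits_le _ _ := Nat.zero_le _
  calls_eq := by simp [EstState.init]
  vInf_le := hD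
  vInf_nonneg := zero_le_one
  done h := absurd h (by simp only [EstState.init]; norm_num)

variable [MeasurableSpace S] [MeasurableSingletonClass S] [Nonempty A]
  {P : S → A → PMF S} {ε δ : ℝ} {x : S → A → ℕ → S}

/-- On accurate samples, an iteration that is entered succeeds and preserves the invariant. -/
theorem LoopInvariant.exists_iteration (hP : Communicating P) (hε : 0 < ε) (hε1 : ε ≤ 1)
    (hx : ∀ s a n, 0 < n → ∑ s', |(P s a s').toReal - empirical x n s a s'| ≤
      confWidth (Fintype.card S) (Fintype.card A) δ n)
    (hne : ∃ n : ℕ, 0 < n ∧ confWidth (Fintype.card S) (Fintype.card A) δ n ≤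
      ε / (8 * (diameter P).toReal))
    {st : EstState S A}
    (hst : LoopInvariant ε (diameter P).toReal (sampleSize (Fintype.card S) (Fintype.card A) δ
      (ε / (8 * (diameter P).toReal))) st) (hW : st.W < st.vInf) :
    ∃ st', Iteration ε δ x st st' ∧ st'.W = 2 * st.W ∧
      LoopInvariant ε (diameter P).toReal (sampleSize (Fintype.card S) (Fintype.card A) δ
        (ε / (8 * (diameter P).toReal))) st' := by
  classical
  set D := (diameter P).toReal with hDdef
  set N₀ := sampleSize (Fintype.card S) (Fintype.card A) δ (ε / (8 * D)) with hN₀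
  have hW0 := hst.half_le_W
  -- Entering the loop forces W < D, so the doubled guess is below 2D and the new `η` is at least
  -- ε/(8D).
  have hWD : st.W < D := hW.trans_le hst.vInf_le
  set η := ε / (4 * (2 * st.W)) with hη
  have hηpos : 0 < η := by positivity
  have hηle : ε / (8 * D) ≤ η := by
    rw [hη]
    exact div_le_div_of_nonneg_left hε.le (by positivity) (by linarith)
  obtain ⟨hNpos, hNw, hNle⟩ := sampleSize_spec hηle hne
  set N := sampleSize (Fintype.card S) (Fintype.card A) δ η with hN
  set Pl := plausible x N η with hPldef
  have hPl : ∀ s a, Pl s a ⊆ stdSimplex ℝ S := fun s a q hq => hq.1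
  -- Optimism: the true law is plausible, so the optimistic operator lies below the true Bellman
  -- operator.
  have hmem : ∀ s a, (fun s' => (P s a s').toReal) ∈ Pl s a := fun s a =>
    ⟨PMF_toReal_mem_stdSimplex _, (hx s a N hNpos).trans hNw⟩
  have hPlne : ∀ s a, (Pl s a).Nonempty := fun s a => ⟨_, hmem s a⟩
  have hclose : ∀ s a, ∀ q ∈ Pl s a, ∑ s', |(P s a s').toReal - q s'| ≤ 2 * η := by
    intro s a q hq
    calc ∑ s', |(P s a s').toReal - q s'|
        ≤ ∑ s', (|(P s a s').toReal - empirical x N s a s'| +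
            |q s' - empirical x N s a s'|) := Finset.sum_le_sum fun s' _ => by
          rw [abs_sub_comm (q s')]
          exact abs_sub_le _ _ _
      _ ≤ 2 * η := by
          rw [Finset.sum_add_distrib, two_mul]
          exact add_le_add (hmem s a).2 hq.2
  have hc : ∀ (s : S) (a : A), (0 : ℝ) ≤ (fun (_ : S) (_ : A) => (1 : ℝ)) s a :=
    fun _ _ => zero_le_one
  have hsup : ∀ g, ∃ V : S → ℝ, 0 ≤ V ∧ (∀ s, V s ≤ D) ∧
      extBellman (fun (_ : S) (_ : A) => (1 : ℝ)) g Pl V ≤ V := by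
    intro g
    obtain ⟨V, hV0, hVg, hVD, hVB⟩ := exists_bellman_supersolution P hP g
    refine ⟨V, hV0, hVD, fun s => ?_⟩
    by_cases hs : s = g
    · rw [hs, extBellman_goal, hVg]
    · obtain ⟨a, ha⟩ := hVB s hs
      rw [extBellman_of_ne V hs]
      refine (ciInf_le (Set.finite_range _).bddBelow a).trans (le_trans ?_ ha)
      exact add_le_add le_rfl (csInf_le (bddBelow_image_sum_mul (hPl s a) hV0)
        ⟨_, hmem s a, rfl⟩)
  have hprec : (0 : ℝ) < min 1 ε / 2 := by positivity
  have hex : ∀ g, ∃ v : S → ℝ,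
      EVIReturns (fun (_ : S) (_ : A) => (1 : ℝ)) g Pl (min 1 ε / 2) v := by
    intro g
    obtain ⟨V, hV0, -, hVB⟩ := hsup g
    exact exists_EVIReturns hc hPl hPlne hV0 hVB hprec
  choose v hv using hex
  have hv0 : ∀ g, 0 ≤ v g := by
    intro g
    obtain ⟨j, -, hj⟩ := hv g
    rw [hj]
    exact eviIter_nonneg hc hPl j
  have hvD : ∀ g s, v g s ≤ D := by
    intro g s
    obtain ⟨V, hV0, hVD, hVB⟩ := hsup g
    obtain ⟨j, -, hj⟩ := hv g
    rw [hj]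
    exact (eviIter_le hc hPl hPlne hV0 hVB j s).trans (hVD s)
  set M := ⨆ gs : {gs : S × S // gs.2 ≠ gs.1}, v gs.1.1 gs.1.2 with hMdef
  have hM0 : 0 ≤ M := Real.iSup_nonneg fun gs => hv0 _ _
  have hvM : ∀ g s, v g s ≤ M := by
    intro g s
    by_cases hs : s = g
    · obtain ⟨j, -, hj⟩ := hv g
      rw [hs, hj, eviIter_goal]
      exact hM0
    · exact le_ciSup (f := fun gs : {gs : S × S // gs.2 ≠ gs.1} => v gs.1.1 gs.1.2)
        (Set.finite_range _).bddAbove ⟨(g, s), hs⟩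
  have hMD : M ≤ D := by
    refine Real.iSup_le (fun gs => hvD _ _) (by linarith)
  refine ⟨⟨2 * st.W, η, M, fun s a => max (st.visits s a) N,
    st.calls + ∑ s, ∑ a, (max (st.visits s a) N - st.visits s a)⟩,
    ⟨hW, rfl, rfl, fun s a => rfl, rfl, v, hv, rfl⟩, rfl, ?_⟩
  refine ⟨by dsimp only; linarith, fun s a => max_le (hst.visits_le s a) hNle, ?_, hMD, hM0,
    fun hle => ⟨rfl, ?_⟩⟩
  · dsimp only
    rw [hst.calls_eq, ← Finset.sum_add_distrib]
    refine Finset.sum_congr rfl fun s _ => ?_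
    rw [← Finset.sum_add_distrib]
    exact Finset.sum_congr rfl fun a _ => by omega
  · dsimp only at hle ⊢
    -- The exit test bounds `M` by the doubled guess in the denominator of `η`.
    have hηM : η * M ≤ ε / 4 := by
      calc η * M ≤ η * (2 * st.W) := by gcongr
        _ = ε / 4 := by rw [hη]; field_simp
    refine diameter_toReal_le_div P hM0 (by linarith) fun g =>
      ⟨v g, hv0 g, hvM g, fun s hs => ?_⟩
    have := (hv g).exists_progress hPl hPlne
      (p := fun s a s' => (P s a s').toReal) (fun s a => PMF_toReal_mem_stdSimplex _)
      hclose (hv0 g) (hvM g) hM0 hs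
    rwa [min_eq_right hε1] at this

/-- `W` doubles while `vInf` stays at most D, so the exit test succeeds at the latest when W ≥ D;
`k` bounds the doublings still needed. -/
theorem LoopInvariant.exists_final (hP : Communicating P) (hε : 0 < ε) (hε1 : ε ≤ 1)
    (hx : ∀ s a n, 0 < n → ∑ s', |(P s a s').toReal - empirical x n s a s'| ≤
      confWidth (Fintype.card S) (Fintype.card A) δ n)
    (hne : ∃ n : ℕ, 0 < n ∧ confWidth (Fintype.card S) (Fintype.card A) δ n ≤
      ε / (8 * (diameter P).toReal)) (k : ℕ) (st : EstState S A)
    (hst : LoopInvariant ε (diameter P).toReal (sampleSize (Fintype.card S) (Fintype.card A) δ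
      (ε / (8 * (diameter P).toReal))) st) (hk : (diameter P).toReal ≤ 2 ^ k * st.W) :
    ∃ st', Relation.ReflTransGen (Iteration ε δ x) st st' ∧ st'.vInf ≤ st'.W ∧
      LoopInvariant ε (diameter P).toReal (sampleSize (Fintype.card S) (Fintype.card A) δ
        (ε / (8 * (diameter P).toReal))) st' := by
  induction k generalizing st with
  | zero =>
    rw [pow_zero, one_mul] at hk
    exact ⟨st, .refl, hst.vInf_le.trans hk, hst⟩
  | succ k ih =>
    rcases le_or_gt st.vInf st.W with h | h
    · exact ⟨st, .refl, h, hst⟩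
    · obtain ⟨st₁, hit, hW₁, hst₁⟩ := hst.exists_iteration hP hε hε1 hx hne h
      obtain ⟨st₂, h₂, h₂', h₂''⟩ := ih st₁ hst₁ (by rw [hW₁]; rw [pow_succ] at hk; linarith)
      exact ⟨st₂, .head hit h₂, h₂', h₂''⟩

/-- On accurate samples, the procedure terminates with a correct estimate after few calls. -/
theorem exists_returns [Nontrivial S] (hP : Communicating P) (hε : 0 < ε) (hε1 : ε ≤ 1)
    (hx : ∀ s a n, 0 < n → ∑ s', |(P s a s').toReal - empirical x n s a s'| ≤
      confWidth (Fintype.card S) (Fintype.card A) δ n)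
    (hne : ∃ n : ℕ, 0 < n ∧ confWidth (Fintype.card S) (Fintype.card A) δ n ≤
      ε / (8 * (diameter P).toReal)) :
    ∃ (Dhat : ℝ) (τ : ℕ), Returns ε δ x Dhat τ ∧ (diameter P).toReal ≤ Dhat ∧
      Dhat ≤ (1 + ε * (1 + ε) / 2) * (1 + ε) * (diameter P).toReal ∧
      τ ≤ Fintype.card S * Fintype.card A * sampleSize (Fintype.card S) (Fintype.card A) δ
        (ε / (8 * (diameter P).toReal)) := by
  have hD1 : 1 ≤ (diameter P).toReal := by
    have := ENNReal.toReal_mono (diameter_lt_top P hP).ne (one_le_diameter P)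
    rwa [ENNReal.toReal_one] at this
  -- The factor 2 compensates the initial guess 1/2.
  obtain ⟨k, hk⟩ := pow_unbounded_of_one_lt (2 * (diameter P).toReal) (one_lt_two (α := ℝ))
  obtain ⟨st, hreach, hend, hinv⟩ := LoopInvariant.exists_final hP hε hε1 hx hne k _
    (LoopInvariant.init _ hD1 _) (by simp only [EstState.init]; linarith)
  obtain ⟨hη, hDle⟩ := hinv.done hend
  have hW := hinv.half_le_W
  have hη0 : 0 ≤ st.η := by rw [hη]; positivity
  have hηM : st.η * st.vInf ≤ ε / 4 := by
    calc st.η * st.vInf ≤ st.η * st.W := by gcongr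
      _ = ε / 4 := by rw [hη]; field_simp
  refine ⟨_, _, ⟨st, hreach, hend, rfl, rfl⟩,
    le_estimate hε hε1 hη0 hinv.vInf_nonneg hηM hDle,
    estimate_le hε hinv.vInf_nonneg hηM hinv.vInf_le, ?_⟩
  rw [hinv.calls_eq]
  calc _ ≤ ∑ _s : S, ∑ _a : A, sampleSize (Fintype.card S) (Fintype.card A) δ
        (ε / (8 * (diameter P).toReal)) :=
        Finset.sum_le_sum fun s _ => Finset.sum_le_sum fun a _ => hinv.visits_le s a
    _ = _ := by simp [mul_assoc]

end Procedure

/-! ### Order of magnitude of the sample size -/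

/-- The logarithm is at most 1 + log 2050 + 6 log T ≤ 9 + 6 log T, and log T ≥ 1. The hypothesis on
`x` fits the sample size n ≤ 2049 L Z, where L ≤ T and Z ≤ T⁵. -/
theorem log_exp_one_mul_one_add_le {T x : ℝ} (hT : Real.exp 1 ≤ T) (hx : 0 ≤ x)
    (hxT : x ≤ 2049 * T ^ 6) : Real.log (Real.exp 1 * (1 + x)) ≤ 15 * Real.log T := by
  have hT1 : 1 ≤ T := (Real.one_le_exp zero_le_one).trans hT
  have hL1 : 1 ≤ Real.log T := (Real.le_log_iff_exp_le (by linarith)).2 hT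
  have h1 : 1 + x ≤ 2050 * T ^ 6 := by
    have : 1 ≤ T ^ 6 := one_le_pow₀ hT1
    linarith
  have h2 : Real.log 2050 ≤ 8 := by
    rw [Real.log_le_iff_le_exp (by norm_num), show (8 : ℝ) = (8 : ℕ) * 1 by norm_num,
      Real.exp_nat_mul]
    calc (2050 : ℝ) ≤ 2.7 ^ 8 := by norm_num
      _ ≤ Real.exp 1 ^ 8 := by
        gcongr
        linarith [Real.exp_one_gt_d9]
  have h3 := Real.log_le_log (by linarith) h1
  rw [Real.log_mul (by norm_num) (by positivity), Real.log_pow] at h3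
  rw [Real.log_mul (Real.exp_pos 1).ne' (by linarith), Real.log_exp]
  push_cast at h3
  linarith

theorem exists_confWidth_le {nS nA : ℕ} (hS : 2 ≤ nS) (hA : 1 ≤ nA) {D ε δ : ℝ} (hD : 1 ≤ D)
    (hε : 0 < ε) (hε1 : ε ≤ 1) (hδ : 0 < δ) (hδ1 : δ < 1) :
    ∃ n : ℕ, 0 < n ∧ confWidth nS nA δ n ≤ ε / (8 * D) ∧
      (n : ℝ) ≤ 2049 * Real.log (2 + nS + nA + D + 1 / ε + Real.log (1 / δ)) *
        (D ^ 2 / ε ^ 2 * (Real.log (1 / δ) + nS)) := by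
  set l := Real.log (1 / δ) with hl
  have hl0 : 0 ≤ l := Real.log_nonneg (by rw [le_div_iff₀ hδ]; linarith)
  have hSr : (2 : ℝ) ≤ nS := by exact_mod_cast hS
  have hAr : (1 : ℝ) ≤ nA := by exact_mod_cast hA
  have hinv : 1 ≤ 1 / ε := by rw [le_div_iff₀ hε]; linarith
  set T := 2 + (nS : ℝ) + nA + D + 1 / ε + l with hT
  have hT7 : 7 ≤ T := by linarith
  set L := Real.log T with hL
  have hexpT : Real.exp 1 ≤ T := by linarith [Real.exp_one_lt_d9]
  have hL1 : 1 ≤ L := (Real.le_log_iff_exp_le (by linarith)).2 hexpT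
  have hLT : L ≤ T := (Real.log_le_sub_one_of_pos (by linarith)).trans (by linarith)
  set Z := D ^ 2 / ε ^ 2 * (l + nS) with hZ
  clear_value Z L T l
  have hZ1 : 1 ≤ Z := by
    have h1 : 1 ≤ D ^ 2 / ε ^ 2 := by
      rw [le_div_iff₀ (by positivity)]
      nlinarith
    nlinarith
  have hLZ : 1 ≤ L * Z := by nlinarith
  -- Rounding 2048 L Z up costs at most one more L Z, as L Z ≥ 1.
  obtain ⟨n, hn1, hn2⟩ : ∃ n : ℕ, 2048 * L * Z ≤ n ∧ (n : ℝ) ≤ 2049 * L * Z := by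
    refine ⟨⌈2048 * L * Z⌉₊, Nat.le_ceil _, ?_⟩
    have := (Nat.ceil_lt_add_one (by positivity : 0 ≤ 2048 * L * Z)).le
    linarith
  have hnpos : 0 < (n : ℝ) := lt_of_lt_of_le (by positivity) hn1
  refine ⟨n, by exact_mod_cast hnpos, ?_, hn2⟩
  unfold confWidth
  rw [Real.sqrt_le_iff]
  refine ⟨by positivity, ?_⟩
  rw [div_le_iff₀ hnpos]
  have hlogSA : Real.log (nS * nA / δ) ≤ 2 * L + l := by
    rw [show (nS * nA / δ : ℝ) = nS * nA * (1 / δ) by ring,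
      Real.log_mul (by positivity) (by positivity), Real.log_mul (by positivity) (by positivity),
      ← hl]
    have h1 : Real.log nS ≤ L := by rw [hL]; exact Real.log_le_log (by linarith) (by linarith)
    have h2 : Real.log nA ≤ L := by rw [hL]; exact Real.log_le_log (by linarith) (by linarith)
    linarith
  have hZT : Z ≤ T ^ 5 := by
    have h1 : D ^ 2 / ε ^ 2 = D ^ 2 * (1 / ε) ^ 2 := by field_simp
    rw [hZ, h1, show T ^ 5 = T ^ 2 * T ^ 2 * T by ring]
    have h2 : D ≤ T := by linarith
    have h3 : 1 / ε ≤ T := by linarith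
    have h4 : l + nS ≤ T := by linarith
    gcongr
  have hlogn : Real.log (Real.exp 1 * (1 + n / ((nS : ℝ) - 1))) ≤ 15 * L := by
    rw [hL]
    have hdiv : (n : ℝ) / ((nS : ℝ) - 1) ≤ n := div_le_self hnpos.le (by linarith)
    have h2 : L * Z ≤ T * T ^ 5 := mul_le_mul hLT hZT (by linarith) (by linarith)
    have h4 : T * T ^ 5 = T ^ 6 := by ring
    exact log_exp_one_mul_one_add_le hexpT (div_nonneg hnpos.le (by linarith)) (by linarith)
  -- The constant 2048 is 32 · 64: 64 cancels the square of 8 in ε/(8D), and 32 L (l + S) dominates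
  -- the numerator 2(2L + l) + 30 L (S - 1) of the squared width.
  have hrhs : 32 * L * (l + nS) ≤ (ε / (8 * D)) ^ 2 * n := by
    calc 32 * L * (l + nS) = (ε / (8 * D)) ^ 2 * (2048 * L * Z) := by
          have : (ε / (8 * D)) ^ 2 * (D ^ 2 / ε ^ 2) = 1 / 64 := by field_simp; norm_num
          calc 32 * L * (l + nS) = 2048 * L * (l + nS) * (1 / 64) := by ring
            _ = (ε / (8 * D)) ^ 2 * (2048 * L * Z) := by rw [← this, hZ]; ring
      _ ≤ _ := by gcongr
  refine le_trans ?_ hrhs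
  have h1 : 2 * ((nS : ℝ) - 1) * Real.log (Real.exp 1 * (1 + n / ((nS : ℝ) - 1))) ≤
      2 * ((nS : ℝ) - 1) * (15 * L) :=
    mul_le_mul_of_nonneg_left hlogn (by linarith)
  have h2 : l ≤ L * l := le_mul_of_one_le_left hl0 hL1
  have h3 : 0 ≤ L * nS := by positivity
  linarith

theorem card_mul_sampleSize_le {nS nA : ℕ} (hS : 2 ≤ nS) (hA : 1 ≤ nA) {D ε δ : ℝ} (hD : 1 ≤ D)
    (hε : 0 < ε) (hε1 : ε ≤ 1) (hδ : 0 < δ) (hδ1 : δ < 1) :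
    ((nS * nA * sampleSize nS nA δ (ε / (8 * D)) : ℕ) : ℝ) ≤
      2049 * (D ^ 2 * nS * nA / ε ^ 2 * Real.log (1 / δ) + D ^ 2 * (nS : ℝ) ^ 2 * nA / ε ^ 2) *
        Real.log (2 + nS + nA + D + 1 / ε + Real.log (1 / δ)) ^ 1 := by
  obtain ⟨n, hn, hw, hle⟩ := exists_confWidth_le hS hA hD hε hε1 hδ hδ1
  have h1 : sampleSize nS nA δ (ε / (8 * D)) ≤ n := Nat.sInf_le ⟨hn, hw⟩
  have h2 : (sampleSize nS nA δ (ε / (8 * D)) : ℝ) ≤ n := by exact_mod_cast h1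
  push_cast
  calc (nS * nA * sampleSize nS nA δ (ε / (8 * D)) : ℝ)
      ≤ nS * nA * (2049 * Real.log (2 + nS + nA + D + 1 / ε + Real.log (1 / δ)) *
        (D ^ 2 / ε ^ 2 * (Real.log (1 / δ) + nS))) := by
          gcongr
          exact h2.trans hle
    _ = _ := by ring

end DiameterEstimation

theorem mainTheorem8 :
    ∃ C : ℝ, 0 < C ∧ ∃ k : ℕ,
      ∀ (S : Type*) (A : Type*) [Fintype S] [Nontrivial S] [Fintype A] [Nonempty A]
        [MeasurableSpace S] [MeasurableSingletonClass S]
        (P : S → A → PMF S), DiameterEstimation.Communicating P →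
      ∀ ε δ : ℝ, 0 < ε → ε ≤ 1 → 0 < δ → δ < 1 →
        -- with probability at least `1 - δ`, correctness and sample bound
        (∀ (Ω : Type*) [MeasurableSpace Ω] (μ : Measure Ω) [IsProbabilityMeasure μ]
          (X : S → A → ℕ → Ω → S), (∀ s a n, Measurable (X s a n)) →
          (∀ s a n, μ.map (X s a n) = (P s a).toMeasure) →
          iIndepFun (fun i : S × A × ℕ => X i.1 i.2.1 i.2.2) μ →
          ENNReal.ofReal (1 - δ) ≤ μ {ω | ∃ (Dhat : ℝ) (τ : ℕ),
            DiameterEstimation.Returns ε δ (fun s a n => X s a n ω) Dhat τ ∧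
            (DiameterEstimation.diameter P).toReal ≤ Dhat ∧
            Dhat ≤ (1 + ε * (1 + ε) / 2) * (1 + ε) * (DiameterEstimation.diameter P).toReal ∧
            τ ≤ Fintype.card S * Fintype.card A *
              DiameterEstimation.sampleSize (Fintype.card S) (Fintype.card A) δ
                (ε / (8 * (DiameterEstimation.diameter P).toReal))}) ∧
        -- order of magnitude of the sample bound
        ((Fintype.card S * Fintype.card A *
            DiameterEstimation.sampleSize (Fintype.card S) (Fintype.card A) δ
              (ε / (8 * (DiameterEstimation.diameter P).toReal)) : ℕ) : ℝ) ≤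
          C * ((DiameterEstimation.diameter P).toReal ^ 2 * Fintype.card S * Fintype.card A / ε ^ 2
                * Real.log (1 / δ) +
              (DiameterEstimation.diameter P).toReal ^ 2 * (Fintype.card S : ℝ) ^ 2
                * Fintype.card A / ε ^ 2) *
            Real.log (2 + Fintype.card S + Fintype.card A + (DiameterEstimation.diameter P).toReal
              + 1 / ε + Real.log (1 / δ)) ^ k := by
  refine ⟨2049, by norm_num, 1, ?_⟩
  intro S A _ _ _ _ _ _ P hP ε δ hε hε1 hδ hδ1
  have hD1 : 1 ≤ (DiameterEstimation.diameter P).toReal := by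
    have := ENNReal.toReal_mono (DiameterEstimation.diameter_lt_top P hP).ne
      (DiameterEstimation.one_le_diameter P)
    rwa [ENNReal.toReal_one] at this
  have hS : 2 ≤ Fintype.card S := Fintype.one_lt_card
  have hA : 1 ≤ Fintype.card A := Fintype.card_pos
  refine ⟨?_, DiameterEstimation.card_mul_sampleSize_le hS hA hD1 hε hε1 hδ hδ1⟩
  intro Ω _ μ _ X hX hlaw hind
  obtain ⟨n, hn, hw, -⟩ := DiameterEstimation.exists_confWidth_le hS hA hD1 hε hε1 hδ hδ1
  -- The confidence event is contained in the success event, by the deterministic analysis applied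
  -- to each outcome.
  refine (DiameterEstimation.ofReal_le_measure_confidence P hδ X hX hlaw hind).trans
    (measure_mono fun ω hω => ?_)
  exact DiameterEstimation.exists_returns hP hε hε1 hω ⟨n, hn, hw⟩
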